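/- Let $k$ be a field, and for a locally closed set $Z \subseteq \mathbb{R}$ let $k_Z$ be the sheaf on $\mathbb{R}$ that is the constant sheaf with stalk $k$ on $Z$, extended by zero. Let $\mathscr{L}$ be a cochain complex of sheaves of $k$-vector spaces on $\mathbb{R}$ such that $\mathscr{L}^n \simeq \bigoplus_{j \in J_n} k_{(j,+\infty)}$ for every $n \in \mathbb{Z}$, where the $J_n$ are finite multisets of real numbers, empty for all but finitely many $n$ (a finite open $\mathrm{int}(\Lambda)$-complex, $\Lambda = [0,+\infty)$). Every morphism $\varphi : k_{(b,+\infty)} \to k_{(c,+\infty)}$ has a scalar $a(\varphi) \in k$, the constant value of $\varphi(1)$, where $1$ is the unit section of $k_{(b,+\infty)}$ over $(b,+\infty)$; it vanishes unless $c \le b$. Let $L$ be the associated complex of free persistence modules over $(\mathbb{R},\le)$: $L^n = \bigoplus_{j \in J_n} k^{[j,+\infty)}$, with differentials having the same matrices of scalars as those of $\mathscr{L}$, with respect to the inclusions $k^{[b,+\infty)} \to k^{[c,+\infty)}$, $c \le b$. (Here $k^A$ denotes the indicator module of a convex subset $A$ of a poset: it is $k$ on $A$ and $0$ elsewhere, with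 identities as structure maps inside $A$.) Let $x_1 < \dots < x_m$ be the distinct elements of $\bigcup_n J_n$, let $[m] = \{0, 1, \dots, m\}$, and let $i : [m] \to \mathbb{R}$ be given by $i(r) = x_r$ for $1 \le r \le m$ and $i(0) = x_1 - 1$ (if $m = 0$, $i(0)$ is arbitrary, say $0$). Let $i^{-1}L = L \circ i$, a complex of persistence modules over $[m]$. For each $n \in \mathbb{Z}$, let $\mathbf{B}^n(i^{-1}L)$ be the barcode of $H^n(i^{-1}L)$, i.e. the unique multiset of nonempty intervals of $[m]$ such that $H^n(i^{-1}L) \simeq \bigoplus_{I \in \mathbf{B}^n(i^{-1}L)} k^I$, and let $\mathbf{B}^n(\mathscr{L})$ be the barcode of the cohomology sheaf $H^n(\mathscr{L})$, i.e. the unique locally finite multiset of nonempty intervals of $\mathbb{R}$ such that $H^n(\mathscr{L}) \simeq \bigoplus_{I \in \mathbf{B}^n(\mathscr{L})} k_I$. For an interval $I = \{r, r+1, \dots, s\}$ of $[m]$ put $$ i_!(I) = \begin{cases} [i(r), i(s+1)) & \text{if } s \ne m, \\ [i(r), +\infty) & \text{if } s = m, \end{cases} $$ and for a nonempty interval $I$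 of $\mathbb{R}$ put $\alpha^{-1}(I) = \mathrm{int}(\Omega) \cap \overline{F}$ (Euclidean interior and closure), where $\Omega$ is the smallest upper set and $F$ the smallest lower set containing $I$, so that $I = \Omega \cap F$; thus $\alpha^{-1}([a,b)) = (a,b]$ and $\alpha^{-1}([a,+\infty)) = (a,+\infty)$. Then, for every $n \in \mathbb{Z}$, both barcodes exist and are unique, and $I \mapsto \alpha^{-1} i_!(I)$ is a well-defined bijection of multisets from $\mathbf{B}^n(i^{-1}L)$ onto $\mathbf{B}^n(\mathscr{L})$. -/

import Mathlib

open CategoryTheory CategoryTheory.Limits TopologicalSpace Opposite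
open scoped Topology

universe u

attribute [local instance] Abelian.hasFiniteBiproducts

noncomputable section

namespace ConicComplex

/-! ### The sheaf `k_Z` on a topological space -/

/-- The sections over `U` of the sheaf `k_Z`, for a locally closed subset `Z` of `X`: the functions
on `U` that vanish outside `Z`, are locally constant on `U ∩ Z`, and whose support is closed
in `U`. In other words these are the sections over `U ∩ Z` of the constant sheaf on `Z` whose
support is closed in `U`, i.e. the sections of the extension by zero of the constant sheaf. -/
def sectionsOn (k : Type u) [Field k] {X : TopCat.{u}} (Z : Set X) (U : Opens X) :
    Submodule k (U → k) where
  carrier := {f | (∀ x : U, x.1 ∉ Z → f x = 0) ∧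
    (∀ x : U, x.1 ∈ Z → ∀ᶠ y in 𝓝 x, y.1 ∈ Z → f y = f x) ∧
    IsClosed {x : U | f x ≠ 0}}
  zero_mem' := by simp
  add_mem' := by
    rintro f g ⟨hf1, hf2, hf3⟩ ⟨hg1, hg2, hg3⟩
    have h1 : ∀ x : U, x.1 ∉ Z → (f + g) x = 0 := fun x hx => by
      simp [hf1 x hx, hg1 x hx]
    have h2 : ∀ x : U, x.1 ∈ Z → ∀ᶠ y in 𝓝 x, y.1 ∈ Z → (f + g) y = (f + g) x := by
      intro x hx
      filter_upwards [hf2 x hx, hg2 x hx] with y h h' hy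
      simp [h hy, h' hy]
    refine ⟨h1, h2, ?_⟩
    rw [← isOpen_compl_iff, isOpen_iff_mem_nhds]
    intro x hx
    have hx0 : (f + g) x = 0 := by simpa using hx
    by_cases hxZ : x.1 ∈ Z
    · filter_upwards [h2 x hxZ] with y hy
      by_cases hyZ : y.1 ∈ Z
      · simpa [hx0] using hy hyZ
      · simpa using h1 y hyZ
    · have a := hf3.isOpen_compl.mem_nhds (x := x) (by simp [hf1 x hxZ])
      have b := hg3.isOpen_compl.mem_nhds (x := x) (by simp [hg1 x hxZ])
      filter_upwards [a, b] with y hy hy'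
      have e1 : f y = 0 := by simpa using hy
      have e2 : g y = 0 := by simpa using hy'
      simp [e1, e2]
  smul_mem' := by
    rintro c f ⟨hf1, hf2, hf3⟩
    refine ⟨fun x hx => by simp [hf1 x hx], fun x hx => ?_, ?_⟩
    · filter_upwards [hf2 x hx] with y h hy
      simp [h hy]
    · by_cases hc : c = 0
      · simp [hc]
      · simpa [hc] using hf3

lemma sectionsOn_restrict {k : Type u} [Field k] {X : TopCat.{u}} {Z : Set X} {U V : Opens X}
    (h : V ≤ U) {f : U → k} (hf : f ∈ sectionsOn k Z U) :
    (fun x : V => f ⟨x.1, h x.2⟩) ∈ sectionsOn k Z V := by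
  obtain ⟨h1, h2, h3⟩ := hf
  have hc : Continuous (fun x : V => (⟨x.1, h x.2⟩ : U)) :=
    Continuous.subtype_mk continuous_subtype_val _
  exact ⟨fun x hx => h1 _ hx, fun x hx => (hc.tendsto x).eventually (h2 ⟨x.1, h x.2⟩ hx),
    h3.preimage hc⟩

/-- The presheaf underlying `k_Z`, with the restriction of functions. -/
def presheafOn (k : Type u) [Field k] (X : TopCat.{u}) (Z : Set X) :
    TopCat.Presheaf (ModuleCat.{u} k) X where
  obj U := ModuleCat.of k (sectionsOn k Z U.unop)
  map h := ModuleCat.ofHom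
    { toFun := fun f => ⟨fun x => f.1 ⟨x.1, h.unop.le x.2⟩, sectionsOn_restrict h.unop.le f.2⟩
      map_add' := fun _ _ => rfl
      map_smul' := fun _ _ => rfl }
  map_id _ := rfl
  map_comp _ _ := rfl

/-- Being a section of `k_Z` is a local condition. -/
def sectionsPredicate (k : Type u) [Field k] (X : TopCat.{u}) (Z : Set X) :
    TopCat.LocalPredicate (fun _ : X => k) where
  pred {U} f := f ∈ sectionsOn k Z U
  res {U V} i f hf := sectionsOn_restrict i.le hf
  locality {U} f hf := by
    have key : ∀ x : U, ∃ V : Opens X, ∃ hV : V ≤ U, ∃ hx : x.1 ∈ V,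
        (fun y : V => f ⟨y.1, hV y.2⟩) ∈ sectionsOn k Z V := by
      intro x
      obtain ⟨V, hx, i, h⟩ := hf x
      exact ⟨V, i.le, hx, h⟩
    have nh : ∀ (x : U) (V : Opens X) (hV : V ≤ U) (hx : x.1 ∈ V) (p : U → Prop),
        (∀ᶠ y in 𝓝 (⟨x.1, hx⟩ : V), p ⟨y.1, hV y.2⟩) → ∀ᶠ y in 𝓝 x, p y := by
      intro x V hV hx p hp
      have he : Topology.IsOpenEmbedding (fun y : V => (⟨y.1, hV y.2⟩ : U)) :=
        Topology.IsOpenEmbedding.of_comp _ U.isOpenEmbedding'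
          (by simpa [Function.comp_def] using V.isOpenEmbedding')
      have := he.map_nhds_eq ⟨x.1, hx⟩
      rw [show x = (⟨x.1, hV hx⟩ : U) from rfl, ← this]
      exact hp
    refine ⟨fun x hx => ?_, fun x hx => ?_, ?_⟩
    · obtain ⟨V, hV, hxV, h⟩ := key x
      exact h.1 ⟨x.1, hxV⟩ hx
    · obtain ⟨V, hV, hxV, h⟩ := key x
      exact nh x V hV hxV _ (h.2.1 ⟨x.1, hxV⟩ hx)
    · rw [← isOpen_compl_iff, isOpen_iff_mem_nhds]
      intro x hx
      obtain ⟨V, hV, hxV, h⟩ := key x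
      have h' : ∀ᶠ y in 𝓝 (⟨x.1, hxV⟩ : V), y ∈ {y : V | f ⟨y.1, hV y.2⟩ ≠ 0}ᶜ :=
        h.2.2.isOpen_compl.mem_nhds hx
      exact nh x V hV hxV (fun y => y ∈ {y : U | f y ≠ 0}ᶜ) h'

lemma presheafOn_isSheaf (k : Type u) [Field k] (X : TopCat.{u}) (Z : Set X) :
    (presheafOn k X Z).IsSheaf := by
  rw [TopCat.Presheaf.isSheaf_iff_isSheaf_comp (forget (ModuleCat.{u} k))]
  exact TopCat.Presheaf.isSheaf_of_iso
    (NatIso.ofComponents (fun U => Iso.refl _) (fun _ => rfl))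
    (TopCat.subpresheafToTypes.isSheaf (sectionsPredicate k X Z))

/-- The sheaf `k_Z` on `X`: the constant sheaf with stalk `k` on the locally closed set `Z`,
extended by zero outside `Z`. -/
def sheafOn (k : Type u) [Field k] (X : TopCat.{u}) (Z : Set X) :
    TopCat.Sheaf (ModuleCat.{u} k) X :=
  ⟨presheafOn k X Z, presheafOn_isSheaf k X Z⟩

/-! ### Sheaves on the real line -/

/-- The real line with its Euclidean topology (lifted to the universe of the field `k`). -/
abbrev Line : TopCat.{u} := TopCat.of (ULift.{u} ℝ)

/-- The category of sheaves of `k`-vector spaces on the real line. -/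
abbrev LineSheaf (k : Type u) [Field k] := TopCat.Sheaf (ModuleCat.{u} k) Line.{u}

/-- The sheaf `k_I` on the real line. -/
def intervalSheaf (k : Type u) [Field k] (I : Set ℝ) : LineSheaf k :=
  sheafOn k Line (ULift.down ⁻¹' I)

/-- The open half-line `(b, +∞)`. -/
def openRay (b : ℝ) : Opens Line.{u} :=
  ⟨ULift.down ⁻¹' Set.Ioi b, isOpen_Ioi.preimage continuous_uliftDown⟩

/-- The section `1` of `k_{(b, +∞)}` over `(b, +∞)`. -/
def raySection (k : Type u) [Field k] (b : ℝ) :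
    sectionsOn k (X := Line.{u}) (ULift.down ⁻¹' Set.Ioi b) (openRay b) :=
  ⟨fun _ => 1, fun x hx => absurd x.2 hx, fun _ _ => Filter.Eventually.of_forall fun _ _ => rfl,
    by simp⟩

/-- The scalar of a morphism `k_{(b, +∞)} ⟶ k_{(c, +∞)}`: the value of the image of the
section `1` over `(b, +∞)`. This image is a constant function, so that it may be
evaluated at the point `b + 1`. -/
def rayCoeff {k : Type u} [Field k] {b c : ℝ}
    (φ : intervalSheaf k (Set.Ioi b) ⟶ intervalSheaf k (Set.Ioi c)) : k :=
  (show sectionsOn k (X := Line.{u}) (ULift.down ⁻¹' Set.Ioi c) (openRay b) from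
    (φ.hom.app (op (openRay b))).hom (raySection k b)).1 ⟨⟨b + 1⟩, by simp [openRay]⟩

lemma ray_section_const {k : Type u} [Field k] {b c : ℝ} {f : openRay.{u} b → k}
    (hf : f ∈ sectionsOn k (X := Line.{u}) (ULift.down ⁻¹' Set.Ioi c) (openRay b))
    (x y : openRay.{u} b) : f x = f y := by
  have hlc : IsLocallyConstant f := by
    rw [IsLocallyConstant.iff_eventually_eq]
    intro z
    by_cases hz : z.1 ∈ (ULift.down ⁻¹' Set.Ioi c : Set Line.{u})
    · have hZ : ∀ᶠ w in 𝓝 z, w.1 ∈ (ULift.down ⁻¹' Set.Ioi c : Set Line.{u}) :=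
        ((openRay.{u} c).isOpen.preimage continuous_subtype_val).mem_nhds hz
      filter_upwards [hf.2.1 z hz, hZ] with w h h'
      exact h h'
    · have h0 := hf.1 z hz
      have := hf.2.2.isOpen_compl.mem_nhds (x := z) (by simp [h0])
      filter_upwards [this] with w hw
      have : f w = 0 := by simpa using hw
      rw [this, h0]
  have hp : _root_.IsPreconnected ((openRay.{u} b : Opens Line.{u}) : Set Line.{u}) := by
    have : ((openRay.{u} b : Opens Line.{u}) : Set Line.{u}) = ULift.up '' Set.Ioi b := by
      ext z
      constructor
      · intro hz
        exact ⟨z.down, hz, rfl⟩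
      · rintro ⟨t, ht, rfl⟩
        exact ht
    rw [this]
    exact isPreconnected_Ioi.image _ continuous_uliftUp.continuousOn
  have : PreconnectedSpace (openRay.{u} b) := isPreconnected_iff_preconnectedSpace.1 hp
  exact hlc.apply_eq_of_preconnectedSpace x y

/-- The action of a morphism on sections over `(d, +∞)`. -/
def rayApp {k : Type u} [Field k] {b c : ℝ} (d : ℝ)
    (φ : intervalSheaf k (Set.Ioi b) ⟶ intervalSheaf k (Set.Ioi c)) :
    sectionsOn k (X := Line.{u}) (ULift.down ⁻¹' Set.Ioi b) (openRay d) →ₗ[k]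
      sectionsOn k (X := Line.{u}) (ULift.down ⁻¹' Set.Ioi c) (openRay d) :=
  (φ.hom.app (op (openRay d))).hom

lemma rayCoeff_eq {k : Type u} [Field k] {b c : ℝ}
    (φ : intervalSheaf k (Set.Ioi b) ⟶ intervalSheaf k (Set.Ioi c)) (x : openRay.{u} b) :
    rayCoeff φ = (rayApp b φ (raySection k b)).1 x :=
  ray_section_const (rayApp b φ (raySection k b)).2 _ _

lemma rayCoeff_of_lt {k : Type u} [Field k] {b c : ℝ} (h : b < c)
    (φ : intervalSheaf k (Set.Ioi b) ⟶ intervalSheaf k (Set.Ioi c)) : rayCoeff φ = 0 := by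
  have hx : b < (b + c) / 2 := by linarith
  rw [rayCoeff_eq φ ⟨⟨(b + c) / 2⟩, hx⟩]
  refine (rayApp b φ (raySection k b)).2.1 _ ?_
  simp only [Set.mem_preimage, Set.mem_Ioi, not_lt]
  linarith

lemma rayCoeff_comp {k : Type u} [Field k] {b c e : ℝ}
    (φ : intervalSheaf k (Set.Ioi b) ⟶ intervalSheaf k (Set.Ioi c))
    (ψ : intervalSheaf k (Set.Ioi c) ⟶ intervalSheaf k (Set.Ioi e)) :
    rayCoeff (φ ≫ ψ) = rayCoeff φ * rayCoeff ψ := by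
  have hx : b + 1 ∈ Set.Ioi b := by simp
  have hcomp : rayApp b (φ ≫ ψ) (raySection k b)
      = rayApp b ψ (rayApp b φ (raySection k b)) := rfl
  rcases lt_or_ge b c with h | h
  · have h0 : rayApp b φ (raySection k b) = 0 := by
      ext x
      rw [← rayCoeff_eq φ x, rayCoeff_of_lt h]
      rfl
    rw [rayCoeff_of_lt h, zero_mul, rayCoeff_eq (φ ≫ ψ) ⟨⟨b + 1⟩, hx⟩, hcomp, h0, map_zero]
    rfl
  · have hle : openRay.{u} b ≤ openRay.{u} c := fun x hx => lt_of_le_of_lt h hx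
    let r : sectionsOn k (X := Line.{u}) (ULift.down ⁻¹' Set.Ioi c) (openRay b) :=
      ⟨_, sectionsOn_restrict hle (raySection k c).2⟩
    have h1 : rayApp b φ (raySection k b) = rayCoeff φ • r := by
      ext x
      rw [← rayCoeff_eq φ x]
      change _ = rayCoeff φ * 1
      rw [mul_one]
    have nat : (rayApp b ψ r).1 ⟨⟨b + 1⟩, hx⟩
        = (rayApp c ψ (raySection k c)).1 ⟨⟨b + 1⟩, hle hx⟩ := by
      have := ψ.hom.naturality (homOfLE hle).op
      have := congrArg (fun g => (show sectionsOn k (X := Line.{u}) (ULift.down ⁻¹' Set.Ioi e)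
        (openRay b) from g.hom (raySection k c)).1 ⟨⟨b + 1⟩, hx⟩) this
      exact this
    rw [rayCoeff_eq (φ ≫ ψ) ⟨⟨b + 1⟩, hx⟩, hcomp, h1, map_smul,
      rayCoeff_eq ψ ⟨⟨b + 1⟩, hle hx⟩, ← nat]
    rfl

lemma rayCoeff_zero {k : Type u} [Field k] {b c : ℝ} :
    rayCoeff (0 : intervalSheaf k (Set.Ioi b) ⟶ intervalSheaf k (Set.Ioi c)) = 0 := rfl

lemma rayCoeff_add {k : Type u} [Field k] {b c : ℝ}
    (φ ψ : intervalSheaf k (Set.Ioi b) ⟶ intervalSheaf k (Set.Ioi c)) :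
    rayCoeff (φ + ψ) = rayCoeff φ + rayCoeff ψ := rfl

lemma rayCoeff_sum {k : Type u} [Field k] {b c : ℝ} {ι : Type*} (s : Finset ι)
    (φ : ι → (intervalSheaf k (Set.Ioi b) ⟶ intervalSheaf k (Set.Ioi c))) :
    rayCoeff (∑ i ∈ s, φ i) = ∑ i ∈ s, rayCoeff (φ i) :=
  map_sum (AddMonoidHom.mk' (rayCoeff (k := k) (b := b) (c := c)) rayCoeff_add) φ s

/-! ### Persistence modules -/

/-- The value at `x` of the indicator module of `A`: it is `k` if `x ∈ A` and `0` otherwise. -/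
def indicatorSpace (k : Type u) [Field k] {P : Type*} (A : Set P) (x : P) : Submodule k k where
  carrier := {c | x ∉ A → c = 0}
  zero_mem' := fun _ => rfl
  add_mem' := fun ha hb h => by simp [ha h, hb h]
  smul_mem' := fun r c hc h => by simp [hc h]

open Classical in
/-- The structure map from `x` to `y` of the indicator module of `A`: the identity of `k` if `x`
and `y` are both in `A`, and zero otherwise. -/
def indicatorStep (k : Type u) [Field k] {P : Type*} (A : Set P) (x y : P) :
    indicatorSpace k A x →ₗ[k] indicatorSpace k A y where
  toFun c := ⟨if y ∈ A then c.1 else 0, fun h => if_neg h⟩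
  map_add' a b := by
    ext
    by_cases h : y ∈ A <;> simp [h]
  map_smul' r a := by
    ext
    by_cases h : y ∈ A <;> simp [h]

open Classical in
/-- The indicator module `k^A` of a convex subset `A` of a preordered set `P`, as a persistence
module over `P`: it is `k` on `A` and `0` outside `A`, and its structure maps between points of `A`
are identities. -/
def indicatorModule (k : Type u) [Field k] {P : Type*} [Preorder P] (A : Set P) [A.OrdConnected] :
    P ⥤ ModuleCat.{u} k where
  obj x := ModuleCat.of k (indicatorSpace k A x)
  map {x y} _ := ModuleCat.ofHom (indicatorStep k A x y)
  map_id x := by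
    apply ModuleCat.hom_ext
    apply LinearMap.ext
    intro c
    apply Subtype.ext
    change (if x ∈ A then c.1 else 0) = c.1
    by_cases h : x ∈ A
    · simp [h]
    · simp [h, c.2 h]
  map_comp {x y z} f g := by
    apply ModuleCat.hom_ext
    apply LinearMap.ext
    intro c
    apply Subtype.ext
    change (if z ∈ A then c.1 else 0) = if z ∈ A then (if y ∈ A then c.1 else 0) else 0
    by_cases hz : z ∈ A
    · by_cases hy : y ∈ A
      · simp [hz, hy]
      · have hx : x ∉ A := fun hx =>
          hy (Set.OrdConnected.out ‹_› hx hz ⟨leOfHom f, leOfHom g⟩)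
        simp [hz, hy, c.2 hx]
    · simp [hz]

/-- The free persistence module `k^{up(b)} = k^{[b, +∞)}` over `ℝ`. -/
abbrev upModule (k : Type u) [Field k] (b : ℝ) : ℝ ⥤ ModuleCat.{u} k :=
  indicatorModule k (Set.Ici b)

/-- The inclusion `k → k` at the points where both `k^{up(b)}` and `k^{up(c)}` are nonzero, if
`c ≤ b`, and zero otherwise. -/
def upStep (k : Type u) [Field k] (b c x : ℝ) :
    indicatorSpace k (Set.Ici b) x →ₗ[k] indicatorSpace k (Set.Ici c) x where
  toFun v := ⟨if c ≤ b then v.1 else 0, fun h => by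
    split_ifs with hcb
    · exact v.2 fun hb => h (le_trans hcb hb)
    · rfl⟩
  map_add' a b := by
    ext
    simp only [Submodule.coe_add]
    split_ifs <;> simp
  map_smul' r a := by
    ext
    simp only [Submodule.coe_smul, RingHom.id_apply]
    split_ifs <;> simp

/-- The canonical morphism `k^{up(b)} ⟶ k^{up(c)}`: the inclusion if `c ≤ b`, and zero otherwise
(in which case there is no nonzero morphism). -/
def upMap (k : Type u) [Field k] (b c : ℝ) : upModule k b ⟶ upModule k c where
  app x := ModuleCat.ofHom (upStep k b c x)
  naturality x y f := by
    apply ModuleCat.hom_ext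
    apply LinearMap.ext
    intro v
    apply Subtype.ext
    classical
    have hv : ¬ b ≤ x → v.1 = 0 := v.2
    change (if c ≤ b then (if b ≤ y then v.1 else 0) else 0)
      = if c ≤ y then (if c ≤ b then v.1 else 0) else 0
    have hxy : x ≤ y := leOfHom f
    by_cases hcb : c ≤ b
    · by_cases hy : b ≤ y
      · simp [hcb, hy, hcb.trans hy]
      · have hv : v.1 = 0 := hv fun hb => hy (hb.trans hxy)
        simp [hv]
    · simp [hcb]

lemma upMap_comp (k : Type u) [Field k] {b c e : ℝ} (hcb : c ≤ b) (hec : e ≤ c) :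
    upMap k b c ≫ upMap k c e = upMap k b e := by
  ext x v
  apply Subtype.ext
  change (if e ≤ c then (if c ≤ b then v.1 else 0) else 0) = if e ≤ b then v.1 else 0
  simp [hcb, hec, hec.trans hcb]

lemma coeff_upMap_comp {k : Type u} [Field k] {b c e : ℝ}
    (φ : intervalSheaf k (Set.Ioi b) ⟶ intervalSheaf k (Set.Ioi c))
    (ψ : intervalSheaf k (Set.Ioi c) ⟶ intervalSheaf k (Set.Ioi e)) :
    (rayCoeff φ • upMap k b c) ≫ (rayCoeff ψ • upMap k c e)
      = rayCoeff (φ ≫ ψ) • upMap k b e := by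
  rw [rayCoeff_comp]
  rcases lt_or_ge b c with h | h
  · simp [rayCoeff_of_lt h φ]
  rcases lt_or_ge c e with h' | h'
  · simp [rayCoeff_of_lt h' ψ]
  rw [Linear.smul_comp, Linear.comp_smul, upMap_comp k h h', smul_smul]

/-! ### Finite open complexes on the line -/

/-- A finite `int(Λ)`-complex `ℒ = int(Λ){J}` on the real line, where `Λ = [0, +∞)`: a cochain
complex of sheaves on `ℝ` whose term in degree `n` is `⨁_{j ∈ J n} k_{(j, +∞)}`, where the `J n`
are finite multisets of real numbers, empty for all but finitely many `n`. -/
structure FiniteOpenComplex (k : Type u) [Field k] where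
  /-- The generators in each degree. -/
  J : ℤ →₀ Multiset ℝ
  /-- The complex of sheaves. -/
  cpx : CochainComplex (LineSheaf k) ℤ
  /-- The description of its terms. -/
  iso : ∀ n : ℤ, cpx.X n ≅ ⨁ fun j : J n => intervalSheaf k (Set.Ioi (j : ℝ))

namespace FiniteOpenComplex

variable {k : Type u} [Field k] (ℒ : FiniteOpenComplex k)

/-- The differential of `ℒ` from degree `n` to degree `p`, read on the direct sums. -/
def diff (n p : ℤ) : (⨁ fun j : ℒ.J n => intervalSheaf k (Set.Ioi (j : ℝ))) ⟶
    ⨁ fun j : ℒ.J p => intervalSheaf k (Set.Ioi (j : ℝ)) :=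
  (ℒ.iso n).inv ≫ ℒ.cpx.d n p ≫ (ℒ.iso p).hom

/-- The component `k_{(j, +∞)} ⟶ k_{(j', +∞)}` of the differential. -/
def component (n p : ℤ) (j : ℒ.J n) (j' : ℒ.J p) :
    intervalSheaf k (Set.Ioi (j : ℝ)) ⟶ intervalSheaf k (Set.Ioi (j' : ℝ)) :=
  biproduct.ι (fun j : ℒ.J n => intervalSheaf k (Set.Ioi (j : ℝ))) j ≫ ℒ.diff n p ≫
    biproduct.π (fun j : ℒ.J p => intervalSheaf k (Set.Ioi (j : ℝ))) j'

lemma sum_component_comp (n p q : ℤ) (j : ℒ.J n) (j'' : ℒ.J q) :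
    ∑ j' : ℒ.J p, ℒ.component n p j j' ≫ ℒ.component p q j' j'' = 0 := by
  have h : ℒ.diff n p ≫ ℒ.diff p q = 0 := by simp [diff]
  have h' : ∀ j' : ℒ.J p, ℒ.component n p j j' ≫ ℒ.component p q j' j''
      = (biproduct.ι _ j ≫ ℒ.diff n p) ≫ (biproduct.π _ j' ≫
          biproduct.ι (fun j : ℒ.J p => intervalSheaf k (Set.Ioi (j : ℝ))) j') ≫
        (ℒ.diff p q ≫ biproduct.π _ j'') := by
    intro j'
    simp [component]
  simp_rw [h']
  rw [← Preadditive.comp_sum, ← Preadditive.sum_comp, biproduct.total, Category.id_comp,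
    Category.assoc, reassoc_of% h, zero_comp, comp_zero]

/-- The complex `L` of free persistence modules over `ℝ` associated with `ℒ`: its term in degree
`n` is `⨁_{j ∈ J n} k^{[j, +∞)}`, and its differentials have the same matrices of scalars as
those of `ℒ`. -/
def free : CochainComplex (ℝ ⥤ ModuleCat.{u} k) ℤ where
  X n := ⨁ fun j : ℒ.J n => upModule k (j : ℝ)
  d n p := biproduct.matrix fun j j' => rayCoeff (ℒ.component n p j j') • upMap k (j : ℝ) (j' : ℝ)
  shape n p h := by
    apply biproduct.hom_ext
    intro j'
    apply biproduct.hom_ext'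
    intro j
    have : ℒ.component n p j j' = 0 := by simp [component, diff, ℒ.cpx.shape n p h]
    simp [this, rayCoeff_zero]
  d_comp_d' n p q _ _ := by
    apply biproduct.hom_ext
    intro j''
    apply biproduct.hom_ext'
    intro j
    have e := sum_component_comp ℒ n p q j j''
    have e' := congrArg rayCoeff e
    rw [rayCoeff_sum, rayCoeff_zero] at e'
    simp only [Category.assoc, biproduct.matrix_π, biproduct.ι_matrix_assoc, zero_comp, comp_zero,
      biproduct.lift_desc, coeff_upMap_comp]
    rw [← Finset.sum_smul, e', zero_smul]

/-- The set of generators of `ℒ` (without multiplicities). -/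
def generators : Finset ℝ := ℒ.J.support.biUnion fun n => (ℒ.J n).toFinset

/-- The number `m` of generators of `ℒ`, without multiplicities. -/
def m : ℕ := ℒ.generators.card

/-- The generators in increasing order, numbered from `0`. -/
def enum : Fin ℒ.m ↪o ℝ := ℒ.generators.orderEmbOfFin rfl

/-- The map `i : [m] = {0, …, m} → ℝ`: for `1 ≤ r ≤ m`, `i r` is the `r`-th generator in increasing
order, and `i 0 = i 1 - 1` (if there are no generators, `i 0` is set to `0`). -/
def i : Fin (ℒ.m + 1) → ℝ :=
  Fin.cases (if h : 0 < ℒ.m then ℒ.enum ⟨0, h⟩ - 1 else 0) ℒ.enum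

lemma i_monotone : Monotone ℒ.i := by
  intro a b hab
  induction a using Fin.cases with
  | zero =>
    induction b using Fin.cases with
    | zero => exact le_rfl
    | succ b =>
      have hm : 0 < ℒ.m := b.pos
      have : ℒ.enum ⟨0, hm⟩ ≤ ℒ.enum b := ℒ.enum.monotone (Nat.zero_le _)
      simp only [i, Fin.cases_zero, Fin.cases_succ, hm, dif_pos]
      linarith
  | succ a =>
    induction b using Fin.cases with
    | zero => exact absurd hab (by simp)
    | succ b =>
      simp only [i, Fin.cases_succ]
      exact ℒ.enum.monotone (Fin.succ_le_succ_iff.1 hab)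

/-- The complex `i⁻¹L = L ∘ i` of persistence modules over `[m]`. -/
def restricted : CochainComplex (Fin (ℒ.m + 1) ⥤ ModuleCat.{u} k) ℤ :=
  (((Functor.whiskeringLeft _ _ (ModuleCat.{u} k)).obj
    ℒ.i_monotone.functor).mapHomologicalComplex _).obj ℒ.free

/-- The map `i_!` from the intervals of `[m]` to those of `ℝ`: it sends `{r, …, s}` to
`[i r, i (s + 1))` if `s ≠ m`, and to `[i r, +∞)` if `s = m`. -/
def iShriek (I : NonemptyInterval (Fin (ℒ.m + 1))) : Set ℝ :=
  if I.snd = Fin.last ℒ.m then Set.Ici (ℒ.i I.fst) else Set.Ico (ℒ.i I.fst) (ℒ.i (I.snd + 1))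

end FiniteOpenComplex

/-! ### Barcodes -/

/-- The elements, repeated according to their multiplicities, of the multiset given by a
multiplicity function `B`. -/
abbrev Bars {α : Type*} (B : α → ℕ) := Σ I : α, Fin (B I)

/-- The multiset `B` of nonempty intervals `{r, …, s}` of the finite linear order `{0, …, m}`, given
by its multiplicities, is the barcode of the persistence module `M`, i.e. `M` is isomorphic to the
direct sum of the indicator modules of the elements of `B`. -/
def IsModuleBarcode {k : Type u} [Field k] {m : ℕ} (M : Fin (m + 1) ⥤ ModuleCat.{u} k)
    (B : NonemptyInterval (Fin (m + 1)) → ℕ) : Prop :=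
  Nonempty (M ≅ ∐ fun b : Bars B => indicatorModule k (Set.Icc b.1.fst b.1.snd))

/-- The multiset `B` of subsets of the line, given by its multiplicities, is the barcode of the
sheaf `F`: it is a locally finite multiset of nonempty intervals (bounded or not), and `F` is
isomorphic to the direct sum of the sheaves `k_I` over the elements `I` of `B`. -/
def IsSheafBarcode {k : Type u} [Field k] (F : LineSheaf k) (B : Set ℝ → ℕ) : Prop :=
  (∀ I, B I ≠ 0 → I.Nonempty ∧ I.OrdConnected) ∧
  (∀ x : ℝ, ∃ U ∈ 𝓝 x, {I | B I ≠ 0 ∧ (I ∩ U).Nonempty}.Finite) ∧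
  Nonempty (F ≅ ∐ fun b : Bars B => intervalSheaf k b.1)

/-- The operation `α⁻¹` on nonempty intervals `I` of `ℝ`. The open sets of the Alexandrov topology
of `ℝ` are the upper sets, so that `I = Ω ∩ F`, where the open set `Ω` is the upper closure of `I`
and the closed set `F` is its lower closure. Then `α⁻¹ I` is the intersection of the
Euclidean interior of `Ω` with the Euclidean closure of `F`. -/
def alphaInv (I : Set ℝ) : Set ℝ :=
  interior (upperClosure I : Set ℝ) ∩ closure (lowerClosure I : Set ℝ)

end ConicComplex

end

/-! In a suitable basis a complex of vector spaces graded by a linear order splits into elementary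
pieces, and the splitting involves only the scalar matrices of the differentials. The sheaf complex
and the persistence complex have the same matrices, so one splitting serves for both.

The scalars near degree `n` form a `MatrixComplex` over `ℝ`: two composable matrices with product
zero, whose nonzero entries do not increase the degree. A `RayDiagram` in an abelian category
abstracts what the `k_{(b,+∞)}` and the pullbacks of the `k^{[b,+∞)}` have in common: scalars act by
morphisms that decrease the index, and the nonzero ones are monomorphisms. Every such diagram turns
graded matrices into morphisms of direct sums. Gaussian elimination restricted to degree-compatible
operations (`exists_pivot`) isolates one entry at a time and splits it off. By induction on the
number of generators (`MatrixComplex.nonempty_bars`), there is one finite family of pairs birth <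
death ≤ ∞ such that, in every abelian category of given universe levels and for every ray diagram,
the homology is the direct sum of the objects `X_b` (for death ∞) and `coker (X_d ⟶ X_b)`.

It remains to identify these objects. For sheaves, `coker (k_{(d,+∞)} ⟶ k_{(b,+∞)})` is `k_{(b,d]}`;
for modules over `[m]` it is the indicator module of the points `x` with `b ≤ i x < d`. The
operations `i_!` and `α⁻¹` carry the second interval to `[b,d)` and then to `(b,d]`.

Uniqueness of barcodes is an elementary Krull–Schmidt argument (`multiplicity_le`): endomorphisms of
an interval object have a multiplicative scalar, which vanishes on endomorphisms that factor through
another interval object. An isomorphism of direct sums therefore gives scalar matrices `M`, `N` with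
`M * N = 1`, whose sizes are the multiplicities, and a rank count compares them. An infinite sheaf
barcode is made finite by testing at a point, where local finiteness applies. -/

noncomputable section

namespace ConicComplex

/-! ### Matrices compatible with a grading -/

section Matrices

variable {k Γ : Type*} [Field k] [LinearOrder Γ]
  {I J K : Type*} {a : I → Γ} {b : J → Γ} {c : K → Γ}

/-- A matrix is admissible, for gradings of its rows and columns, if its nonzero entries do not
increase the degree. -/
def IsAdmissible (a : I → Γ) (b : J → Γ) (M : Matrix I J k) : Prop :=
  ∀ i j, M i j ≠ 0 → b j ≤ a i

lemma IsAdmissible.mul [Fintype J] {M : Matrix I J k} {N : Matrix J K k}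
    (hM : IsAdmissible a b M) (hN : IsAdmissible b c N) : IsAdmissible a c (M * N) := by
  intro i l h
  rw [Matrix.mul_apply] at h
  obtain ⟨j, -, hj⟩ := Finset.exists_ne_zero_of_sum_ne_zero h
  exact (hN j l (right_ne_zero_of_mul hj)).trans (hM i j (left_ne_zero_of_mul hj))

lemma IsAdmissible.one [DecidableEq I] : IsAdmissible a a (1 : Matrix I I k) := by
  intro i j h
  have : i = j := by
    by_contra hij
    exact h (Matrix.one_apply_ne hij)
  rw [this]

lemma IsAdmissible.submatrix {I' J' : Type*} {M : Matrix I J k} (hM : IsAdmissible a b M)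
    (f : I' → I) (g : J' → J) : IsAdmissible (a ∘ f) (b ∘ g) (M.submatrix f g) :=
  fun i j h => hM (f i) (g j) h

/-- The rank one matrix `vecMulVec v w` has square zero because `w ⬝ᵥ v = 0`. With `v` or `w` a
basis vector these products are simultaneous row or column operations. -/
lemma transvection_mul_neg [Fintype I] [DecidableEq I] (v w : I → k) (h : w ⬝ᵥ v = 0) :
    (1 + Matrix.vecMulVec v w) * (1 - Matrix.vecMulVec v w) = 1 := by
  have : Matrix.vecMulVec v w * Matrix.vecMulVec v w = 0 := by
    rw [Matrix.vecMulVec_mul_vecMulVec, h]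
    ext
    simp [Matrix.vecMulVec_apply]
  rw [add_mul, mul_sub, mul_sub, this]
  simp

lemma transvection_neg_mul [Fintype I] [DecidableEq I] (v w : I → k) (h : w ⬝ᵥ v = 0) :
    (1 - Matrix.vecMulVec v w) * (1 + Matrix.vecMulVec v w) = 1 := by
  have := transvection_mul_neg (-v) w (by simp [h])
  simpa [Matrix.neg_vecMulVec, sub_eq_add_neg] using this

/-- A nonzero matrix can be brought by invertible admissible changes of bases to a
form where some nonzero entry is alone in its row and in its column. -/
lemma exists_pivot [Fintype I] [DecidableEq I] [Fintype J] [DecidableEq J]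
    (a : I → Γ) (b : J → Γ) {D : Matrix I J k} (h0 : D ≠ 0) :
    ∃ (i₀ : I) (j₀ : J) (P P' : Matrix I I k) (Q Q' : Matrix J J k),
      IsAdmissible a a P ∧ IsAdmissible a a P' ∧ IsAdmissible b b Q ∧ IsAdmissible b b Q' ∧
      P * P' = 1 ∧ P' * P = 1 ∧ Q * Q' = 1 ∧ Q' * Q = 1 ∧
      (P * D * Q) i₀ j₀ ≠ 0 ∧ ∀ i j, (P * D * Q) i j ≠ 0 → (i = i₀ ↔ j = j₀) := by
  classical
  obtain ⟨i₁, j₁, h₁⟩ : ∃ i j, D i j ≠ 0 := by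
    by_contra! h
    exact h0 (Matrix.ext h)
  -- Only operations compatible with the degrees are allowed: row `i₀` may be added to rows of
  -- larger or equal degree, and column `j₀` to columns of smaller or equal degree. Hence the pivot
  -- row has the least degree among nonzero rows, and the pivot column the greatest degree among the
  -- nonzero entries of that row.
  obtain ⟨i₀, hi₀, hmin⟩ := Finset.exists_min_image
    (Finset.univ.filter fun i => ∃ j, D i j ≠ 0) a ⟨i₁, by simpa using ⟨j₁, h₁⟩⟩
  obtain ⟨j₂, h₂⟩ : ∃ j, D i₀ j ≠ 0 := by simpa using hi₀
  obtain ⟨j₀, hj₀, hmax⟩ := Finset.exists_max_image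
    (Finset.univ.filter fun j => D i₀ j ≠ 0) b ⟨j₂, by simpa using h₂⟩
  have hp : D i₀ j₀ ≠ 0 := by simpa using hj₀
  -- The vectors `v` and `w` are the elimination coefficients: `1 + vecMulVec v e` clears column
  -- `j₀` outside the pivot, and `1 + vecMulVec f w` clears row `i₀`.
  let v : I → k := fun i => if i = i₀ then 0 else -D i j₀ / D i₀ j₀
  let w : J → k := fun j => if j = j₀ then 0 else -D i₀ j / D i₀ j₀
  let e : I → k := Pi.single i₀ 1
  let f : J → k := Pi.single j₀ 1
  have hv : e ⬝ᵥ v = 0 := by simp [e, v]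
  have hw : w ⬝ᵥ f = 0 := by simp [f, w]
  have hV : ∀ i i', Matrix.vecMulVec v e i i' ≠ 0 → a i' ≤ a i := by
    intro i i' h
    rw [Matrix.vecMulVec_apply] at h
    have hi' : i' = i₀ := by
      by_contra hne
      exact h (by simp [e, hne])
    have hi : D i j₀ ≠ 0 := by
      intro hz
      exact h (by simp [v, hz])
    rw [hi']
    exact hmin i (by simpa using ⟨j₀, hi⟩)
  have hW : ∀ j j', Matrix.vecMulVec f w j j' ≠ 0 → b j' ≤ b j := by
    intro j j' h
    rw [Matrix.vecMulVec_apply] at h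
    have hj : j = j₀ := by
      by_contra hne
      exact h (by simp [f, hne])
    have hj' : D i₀ j' ≠ 0 := by
      intro hz
      exact h (by simp [w, hz])
    rw [hj]
    exact hmax j' (by simpa using hj')
  have hP : ∀ i j, ((1 + Matrix.vecMulVec v e) * D : Matrix I J k) i j = D i j + v i * D i₀ j := by
    intro i j
    rw [Matrix.add_mul, Matrix.one_mul, Matrix.add_apply, Matrix.vecMulVec_mul, Matrix.vecMulVec_apply]
    simp [e]
  have hQ : ∀ (M : Matrix I J k) i j,
      (M * (1 + Matrix.vecMulVec f w) : Matrix I J k) i j = M i j + M i j₀ * w j := by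
    intro M i j
    rw [Matrix.mul_add, Matrix.mul_one, Matrix.add_apply, Matrix.mul_vecMulVec, Matrix.vecMulVec_apply]
    simp [f]
  have hadd : ∀ (x y : k), x + y ≠ 0 → x ≠ 0 ∨ y ≠ 0 := by
    intro x y h
    by_contra! h'
    exact h (by simp [h'.1, h'.2])
  have hsub : ∀ (x y : k), x - y ≠ 0 → x ≠ 0 ∨ y ≠ 0 := by
    intro x y h
    by_contra! h'
    exact h (by simp [h'.1, h'.2])
  refine ⟨i₀, j₀, 1 + Matrix.vecMulVec v e, 1 - Matrix.vecMulVec v e,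
    1 + Matrix.vecMulVec f w, 1 - Matrix.vecMulVec f w,
    fun i j h => (hadd _ _ h).elim (IsAdmissible.one i j) (hV i j),
    fun i j h => (hsub _ _ h).elim (IsAdmissible.one i j) (hV i j),
    fun i j h => (hadd _ _ h).elim (IsAdmissible.one i j) (hW i j),
    fun i j h => (hsub _ _ h).elim (IsAdmissible.one i j) (hW i j),
    transvection_mul_neg _ _ hv, transvection_neg_mul _ _ hv,
    transvection_mul_neg _ _ hw, transvection_neg_mul _ _ hw, ?_, ?_⟩
  · rw [hQ, hP]
    simpa [v, w] using hp
  · intro i j h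
    rw [hQ, hP, hP] at h
    constructor
    · intro hi
      by_contra hj
      refine h ?_
      simp only [hi, v, w, hj, if_true, if_false]
      field_simp
      ring
    · intro hj
      by_contra hi
      refine h ?_
      simp only [hj, v, w, hi, if_true, if_false]
      field_simp
      ring

end Matrices

/-! ### Three-term complexes of graded matrices -/

/-- Two composable admissible matrices with product zero, between finite graded sets. -/
structure MatrixComplex (k Γ : Type*) [Field k] [LinearOrder Γ] where
  /-- The first index set. -/
  J₁ : Type
  /-- The second index set. -/
  J₂ : Type
  /-- The third index set. -/
  J₃ : Type
  [fin₁ : Fintype J₁]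
  [fin₂ : Fintype J₂]
  [fin₃ : Fintype J₃]
  [dec₁ : DecidableEq J₁]
  [dec₂ : DecidableEq J₂]
  [dec₃ : DecidableEq J₃]
  /-- The first grading. -/
  a₁ : J₁ → Γ
  /-- The second grading. -/
  a₂ : J₂ → Γ
  /-- The third grading. -/
  a₃ : J₃ → Γ
  /-- The first matrix. -/
  D₁ : Matrix J₁ J₂ k
  /-- The second matrix. -/
  D₂ : Matrix J₂ J₃ k
  adm₁ : IsAdmissible a₁ a₂ D₁
  adm₂ : IsAdmissible a₂ a₃ D₂
  mul_eq_zero : D₁ * D₂ = 0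

namespace MatrixComplex

variable {k Γ : Type*} [Field k] [LinearOrder Γ] (K : MatrixComplex k Γ)

attribute [instance] fin₁ fin₂ fin₃ dec₁ dec₂ dec₃

/-- The number of generators. -/
def size : ℕ := Fintype.card K.J₁ + Fintype.card K.J₂ + Fintype.card K.J₃

/-- The matrix complex obtained by a change of bases. -/
def conj {P₁ P₁' : Matrix K.J₁ K.J₁ k} {P₂ P₂' : Matrix K.J₂ K.J₂ k}
    {P₃ P₃' : Matrix K.J₃ K.J₃ k}
    (h₁ : IsAdmissible K.a₁ K.a₁ P₁) (h₂ : IsAdmissible K.a₂ K.a₂ P₂)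
    (h₂' : IsAdmissible K.a₂ K.a₂ P₂') (h₃' : IsAdmissible K.a₃ K.a₃ P₃')
    (_ : P₁' * P₁ = 1) (e₂' : P₂' * P₂ = 1) (_ : P₃' * P₃ = 1) : MatrixComplex k Γ where
  J₁ := K.J₁
  J₂ := K.J₂
  J₃ := K.J₃
  a₁ := K.a₁
  a₂ := K.a₂
  a₃ := K.a₃
  D₁ := P₁ * K.D₁ * P₂'
  D₂ := P₂ * K.D₂ * P₃'
  adm₁ := (h₁.mul K.adm₁).mul h₂'
  adm₂ := (h₂.mul K.adm₂).mul h₃'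
  mul_eq_zero := by
    have : P₁ * K.D₁ * P₂' * (P₂ * K.D₂ * P₃')
        = P₁ * (K.D₁ * ((P₂' * P₂) * K.D₂)) * P₃' := by simp only [Matrix.mul_assoc]
    rw [this, e₂', Matrix.one_mul, K.mul_eq_zero]
    simp

/-- The matrices are block diagonal with respect to the given subsets. -/
structure IsBlock (p₁ : K.J₁ → Prop) (p₂ : K.J₂ → Prop) (p₃ : K.J₃ → Prop) : Prop where
  block₁ : ∀ i j, K.D₁ i j ≠ 0 → (p₁ i ↔ p₂ j)
  block₂ : ∀ i j, K.D₂ i j ≠ 0 → (p₂ i ↔ p₃ j)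

variable {K}

lemma IsBlock.not {p₁ : K.J₁ → Prop} {p₂ : K.J₂ → Prop} {p₃ : K.J₃ → Prop}
    (h : K.IsBlock p₁ p₂ p₃) : K.IsBlock (¬ p₁ ·) (¬ p₂ ·) (¬ p₃ ·) :=
  ⟨fun i j hij => not_congr (h.block₁ i j hij), fun i j hij => not_congr (h.block₂ i j hij)⟩

/-- The block of a matrix complex. -/
def IsBlock.restrict {p₁ : K.J₁ → Prop} {p₂ : K.J₂ → Prop} {p₃ : K.J₃ → Prop}
    [DecidablePred p₁] [DecidablePred p₂] [DecidablePred p₃] (h : K.IsBlock p₁ p₂ p₃) :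
    MatrixComplex k Γ where
  J₁ := {i // p₁ i}
  J₂ := {i // p₂ i}
  J₃ := {i // p₃ i}
  a₁ := K.a₁ ∘ Subtype.val
  a₂ := K.a₂ ∘ Subtype.val
  a₃ := K.a₃ ∘ Subtype.val
  D₁ := K.D₁.submatrix Subtype.val Subtype.val
  D₂ := K.D₂.submatrix Subtype.val Subtype.val
  adm₁ := K.adm₁.submatrix _ _
  adm₂ := K.adm₂.submatrix _ _
  mul_eq_zero := by
    ext i l
    have e := congrFun (congrFun K.mul_eq_zero i.1) l.1
    rw [Matrix.mul_apply] at e ⊢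
    simp only [Matrix.submatrix_apply, Matrix.zero_apply] at e ⊢
    -- A row of `D₁` inside the block has its nonzero entries inside the block, so the sum over the
    -- block is the full entry of `D₁ * D₂`.
    rw [← Finset.sum_subtype (Finset.univ.filter p₂) (by simp)
      (fun j => K.D₁ i.1 j * K.D₂ j l.1)]
    rw [Finset.sum_filter_of_ne]
    · exact e
    · intro j _ hj
      exact (h.block₁ i.1 j (left_ne_zero_of_mul hj)).1 i.2

end MatrixComplex

/-! ### Ray diagrams and the realization of graded matrices -/

/-- A family of objects indexed by a linear order, with compatible actions of the field by
morphisms that decrease the index, the nonzero ones being monomorphisms. -/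
structure RayDiagram (k Γ : Type*) [Field k] [LinearOrder Γ] (𝒜 : Type*) [Category 𝒜]
    [Preadditive 𝒜] where
  /-- The objects. -/
  obj : Γ → 𝒜
  /-- The morphisms attached to the scalars. -/
  map : ∀ b c, k →+ (obj b ⟶ obj c)
  map_one : ∀ b, map b b 1 = 𝟙 _
  map_comp : ∀ {b c e}, c ≤ b → e ≤ c → ∀ s t, map b c s ≫ map c e t = map b e (s * t)
  mono_map : ∀ {b c}, c ≤ b → Mono (map b c 1)

namespace RayDiagram

section Preadditive

variable {k Γ : Type*} [Field k] [LinearOrder Γ] {𝒜 : Type*} [Category 𝒜] [Preadditive 𝒜]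
  (X : RayDiagram k Γ 𝒜)

lemma isIso_map_self (b : Γ) {s : k} (hs : s ≠ 0) : IsIso (X.map b b s) :=
  ⟨X.map b b s⁻¹, by rw [X.map_comp le_rfl le_rfl, mul_inv_cancel₀ hs, X.map_one],
    by rw [X.map_comp le_rfl le_rfl, inv_mul_cancel₀ hs, X.map_one]⟩

/-- A nonzero scalar is an automorphism of the source followed by the monomorphism of scalar `1`. -/
lemma mono_map_of_ne_zero {b c : Γ} (h : c ≤ b) {s : k} (hs : s ≠ 0) : Mono (X.map b c s) := by
  have := X.isIso_map_self b hs
  have := X.mono_map h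
  rw [← mul_one s, ← X.map_comp le_rfl h]
  infer_instance

variable [HasFiniteBiproducts 𝒜]

/-- The morphism of direct sums given by a matrix of scalars. -/
def real {I J : Type} [Fintype I] [Fintype J] (a : I → Γ) (b : J → Γ) (M : Matrix I J k) :
    (⨁ fun i => X.obj (a i)) ⟶ ⨁ fun j => X.obj (b j) :=
  biproduct.matrix fun i j => X.map (a i) (b j) (M i j)

variable {I J K : Type} [Fintype I] [Fintype J] [Fintype K] {a : I → Γ} {b : J → Γ} {c : K → Γ}

/-- Admissibility is what makes realization multiplicative: `map_comp` is available only along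
decreasing indices, and a term with two nonzero entries has them. The other terms vanish on both
sides. -/
lemma real_comp {M : Matrix I J k} {N : Matrix J K k} (hM : IsAdmissible a b M)
    (hN : IsAdmissible b c N) : X.real a b M ≫ X.real b c N = X.real a c (M * N) := by
  apply biproduct.hom_ext
  intro l
  apply biproduct.hom_ext'
  intro i
  simp only [real, Category.assoc, biproduct.matrix_π, biproduct.ι_matrix_assoc,
    biproduct.lift_desc, biproduct.ι_desc, Matrix.mul_apply, map_sum]
  refine Finset.sum_congr rfl fun j _ => ?_
  by_cases hi : M i j = 0
  · simp [hi]
  by_cases hj : N j l = 0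
  · simp [hj]
  exact X.map_comp (hM i j hi) (hN j l hj) _ _

lemma real_one [DecidableEq I] : X.real a a (1 : Matrix I I k) = 𝟙 _ := by
  apply biproduct.hom_ext
  intro l
  apply biproduct.hom_ext'
  intro i
  simp only [real, biproduct.matrix_π, biproduct.ι_desc, Category.id_comp]
  by_cases h : i = l
  · subst h
    simp [X.map_one]
  · rw [Matrix.one_apply_ne h, map_zero, biproduct.ι_π_ne _ h]

lemma real_zero : X.real a b (0 : Matrix I J k) = 0 := by
  apply biproduct.hom_ext
  intro l
  apply biproduct.hom_ext'
  intro i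
  simp [real]

lemma real_add (M N : Matrix I J k) : X.real a b (M + N) = X.real a b M + X.real a b N := by
  apply biproduct.hom_ext
  intro l
  apply biproduct.hom_ext'
  intro i
  simp [real]

/-- The complex associated with a matrix complex. -/
def complex (K : MatrixComplex k Γ) : ShortComplex 𝒜 where
  X₁ := ⨁ fun j => X.obj (K.a₁ j)
  X₂ := ⨁ fun j => X.obj (K.a₂ j)
  X₃ := ⨁ fun j => X.obj (K.a₃ j)
  f := X.real _ _ K.D₁
  g := X.real _ _ K.D₂
  zero := by rw [X.real_comp K.adm₁ K.adm₂, K.mul_eq_zero, X.real_zero]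

/-- Invertible matrices give isomorphisms. -/
def realIso [DecidableEq I] {P P' : Matrix I I k} (h : IsAdmissible a a P)
    (h' : IsAdmissible a a P') (e : P * P' = 1) (e' : P' * P = 1) :
    (⨁ fun i => X.obj (a i)) ≅ ⨁ fun i => X.obj (a i) where
  hom := X.real a a P
  inv := X.real a a P'
  hom_inv_id := by rw [X.real_comp h h', e, X.real_one]
  inv_hom_id := by rw [X.real_comp h' h, e', X.real_one]

/-- A change of bases does not change the complex up to isomorphism. -/
def conjIso (K : MatrixComplex k Γ) {P₁ P₁' : Matrix K.J₁ K.J₁ k} {P₂ P₂' : Matrix K.J₂ K.J₂ k}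
    {P₃ P₃' : Matrix K.J₃ K.J₃ k}
    (h₁ : IsAdmissible K.a₁ K.a₁ P₁) (h₁' : IsAdmissible K.a₁ K.a₁ P₁')
    (h₂ : IsAdmissible K.a₂ K.a₂ P₂) (h₂' : IsAdmissible K.a₂ K.a₂ P₂')
    (h₃ : IsAdmissible K.a₃ K.a₃ P₃) (h₃' : IsAdmissible K.a₃ K.a₃ P₃')
    (e₁ : P₁ * P₁' = 1) (e₁' : P₁' * P₁ = 1) (e₂ : P₂ * P₂' = 1) (e₂' : P₂' * P₂ = 1)
    (e₃ : P₃ * P₃' = 1) (e₃' : P₃' * P₃ = 1) :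
    X.complex K ≅ X.complex (K.conj h₁ h₂ h₂' h₃' e₁' e₂' e₃') :=
  ShortComplex.isoMk (X.realIso h₁' h₁ e₁' e₁) (X.realIso h₂' h₂ e₂' e₂) (X.realIso h₃' h₃ e₃' e₃)
    (by
      change X.real K.a₁ K.a₁ P₁' ≫ X.real K.a₁ K.a₂ (P₁ * K.D₁ * P₂')
        = X.real K.a₁ K.a₂ K.D₁ ≫ X.real K.a₂ K.a₂ P₂'
      rw [X.real_comp h₁' ((h₁.mul K.adm₁).mul h₂'), X.real_comp K.adm₁ h₂', Matrix.mul_assoc P₁,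
        ← Matrix.mul_assoc P₁', e₁', Matrix.one_mul])
    (by
      change X.real K.a₂ K.a₂ P₂' ≫ X.real K.a₂ K.a₃ (P₂ * K.D₂ * P₃')
        = X.real K.a₂ K.a₃ K.D₂ ≫ X.real K.a₃ K.a₃ P₃'
      rw [X.real_comp h₂' ((h₂.mul K.adm₂).mul h₃'), X.real_comp K.adm₂ h₃', Matrix.mul_assoc P₂,
        ← Matrix.mul_assoc P₂', e₂', Matrix.one_mul])

end Preadditive

end RayDiagram

/-! ### Block decompositions -/

section Inclusions

variable {k : Type*} [Field k] {J : Type} [Fintype J] [DecidableEq J]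

/-- The matrix of the inclusion of the generators satisfying `p`. -/
def inclMatrix (k : Type*) [Field k] (p : J → Prop) : Matrix {j // p j} J k :=
  (1 : Matrix J J k).submatrix Subtype.val id

/-- The matrix of the projection to the generators satisfying `p`. -/
def projMatrix (k : Type*) [Field k] (p : J → Prop) : Matrix J {j // p j} k :=
  (1 : Matrix J J k).submatrix id Subtype.val

variable (p : J → Prop)

lemma inclMatrix_mul {K : Type*} (M : Matrix J K k) :
    inclMatrix k p * M = M.submatrix Subtype.val id := by
  ext i l
  simp [inclMatrix, Matrix.mul_apply, Matrix.one_apply]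

lemma mul_projMatrix {K : Type*} (M : Matrix K J k) :
    M * projMatrix k p = M.submatrix id Subtype.val := by
  ext i l
  simp [projMatrix, Matrix.mul_apply, Matrix.one_apply]

lemma mul_inclMatrix_apply [DecidablePred p] {K : Type*} (M : Matrix K {j // p j} k) (i : K)
    (j : J) : (M * inclMatrix k p : Matrix K J k) i j = if h : p j then M i ⟨j, h⟩ else 0 := by
  simp only [inclMatrix, Matrix.mul_apply, Matrix.one_apply, Matrix.submatrix_apply, id]
  split_ifs with h
  · rw [Finset.sum_eq_single ⟨j, h⟩]
    · simp
    · rintro ⟨b, hb⟩ _ hne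
      simp only [mul_ite, mul_one, mul_zero, ite_eq_right_iff]
      intro e
      exact absurd (Subtype.ext e) hne
    · simp
  · refine Finset.sum_eq_zero ?_
    rintro ⟨b, hb⟩ _
    have : b ≠ j := by
      rintro rfl
      exact h hb
    simp [this]

lemma projMatrix_mul_apply [DecidablePred p] {K : Type*} (M : Matrix {j // p j} K k) (j : J)
    (i : K) : (projMatrix k p * M : Matrix J K k) j i = if h : p j then M ⟨j, h⟩ i else 0 := by
  simp only [projMatrix, Matrix.mul_apply, Matrix.one_apply, Matrix.submatrix_apply, id]
  split_ifs with h
  · rw [Finset.sum_eq_single ⟨j, h⟩]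
    · simp
    · rintro ⟨b, hb⟩ _ hne
      simp only [ite_mul, one_mul, zero_mul, ite_eq_right_iff]
      intro e
      exact absurd (Subtype.ext e.symm) hne
    · simp
  · refine Finset.sum_eq_zero ?_
    rintro ⟨b, hb⟩ _
    have : j ≠ b := by
      rintro rfl
      exact h hb
    simp [this]

lemma inclMatrix_mul_projMatrix [DecidablePred p] : inclMatrix k p * projMatrix k p = 1 := by
  rw [inclMatrix_mul]
  ext i j
  simp [projMatrix, Matrix.one_apply, Subtype.ext_iff]

lemma inclMatrix_mul_projMatrix_of_disjoint {q : J → Prop} (h : ∀ j, p j → ¬ q j) :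
    inclMatrix k p * projMatrix k q = 0 := by
  rw [inclMatrix_mul]
  ext i j
  have : i.1 ≠ j.1 := fun e => h i.1 i.2 (e ▸ j.2)
  simp [projMatrix, this]

lemma projMatrix_mul_inclMatrix_add [DecidablePred p] :
    projMatrix k p * inclMatrix k p + projMatrix k (¬ p ·) * inclMatrix k (¬ p ·)
      = (1 : Matrix J J k) := by
  ext i j
  rw [Matrix.add_apply, projMatrix_mul_apply, projMatrix_mul_apply]
  by_cases h : p i <;> simp [h, inclMatrix] <;> rfl

variable {Γ : Type*} [LinearOrder Γ]

lemma isAdmissible_inclMatrix {J : Type} [DecidableEq J] (p : J → Prop) (a : J → Γ) : IsAdmissible (a ∘ Subtype.val) a (inclMatrix k p) :=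
  IsAdmissible.one.submatrix Subtype.val id

lemma isAdmissible_projMatrix {J : Type} [DecidableEq J] (p : J → Prop) (a : J → Γ) : IsAdmissible a (a ∘ Subtype.val) (projMatrix k p) :=
  IsAdmissible.one.submatrix id Subtype.val

end Inclusions

namespace RayDiagram

open MatrixComplex

section Block

variable {k Γ : Type*} [Field k] [LinearOrder Γ] {𝒜 : Type*} [Category 𝒜] [Preadditive 𝒜]
  [HasFiniteBiproducts 𝒜] (X : RayDiagram k Γ 𝒜) {K : MatrixComplex k Γ}
  {p₁ : K.J₁ → Prop} {p₂ : K.J₂ → Prop} {p₃ : K.J₃ → Prop}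
  [DecidablePred p₁] [DecidablePred p₂] [DecidablePred p₃]

/-- Rows in `p` have no entry outside `q`, so restricting the rows of `D` loses nothing when the
columns are restricted too. This is why the inclusion of a block is a morphism of complexes. -/
lemma inclMatrix_comm {I J : Type} [Fintype I] [DecidableEq I] [Fintype J] [DecidableEq J]
    (p : I → Prop) (q : J → Prop) [DecidablePred q] {D : Matrix I J k}
    (h : ∀ i j, D i j ≠ 0 → (p i ↔ q j)) :
    inclMatrix k p * D =
      (D.submatrix Subtype.val Subtype.val : Matrix {i // p i} {j // q j} k) * inclMatrix k q := by
  ext i j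
  rw [mul_inclMatrix_apply, inclMatrix_mul]
  by_cases hj : q j
  · simp [hj]
  · have : D i.1 j = 0 := by
      by_contra hne
      exact hj ((h _ _ hne).1 i.2)
    simp [hj, this]

lemma projMatrix_comm {I J : Type} [Fintype I] [DecidableEq I] [Fintype J] [DecidableEq J]
    (p : I → Prop) (q : J → Prop) [DecidablePred p] {D : Matrix I J k}
    (h : ∀ i j, D i j ≠ 0 → (p i ↔ q j)) :
    projMatrix k p * (D.submatrix Subtype.val Subtype.val : Matrix {i // p i} {j // q j} k) =
      D * projMatrix k q := by
  ext i j
  rw [projMatrix_mul_apply, mul_projMatrix]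
  by_cases hi : p i
  · simp [hi]
  · have : D i j.1 = 0 := by
      by_contra hne
      exact hi ((h _ _ hne).2 j.2)
    simp [hi, this]

lemma real_incl_comm {I J : Type} [Fintype I] [DecidableEq I] [Fintype J] [DecidableEq J]
    {a : I → Γ} {b : J → Γ} (p : I → Prop) (q : J → Prop) [DecidablePred p] [DecidablePred q]
    {D : Matrix I J k} (hD : IsAdmissible a b D) (h : ∀ i j, D i j ≠ 0 → (p i ↔ q j)) :
    X.real (a ∘ Subtype.val) a (inclMatrix k p) ≫ X.real a b D =
      X.real (a ∘ Subtype.val) (b ∘ Subtype.val) (D.submatrix Subtype.val Subtype.val) ≫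
        X.real (b ∘ Subtype.val) b (inclMatrix k q) := by
  rw [X.real_comp (isAdmissible_inclMatrix _ _) hD, inclMatrix_comm p q h,
    X.real_comp (hD.submatrix _ _) (isAdmissible_inclMatrix _ _)]

lemma real_proj_comm {I J : Type} [Fintype I] [DecidableEq I] [Fintype J] [DecidableEq J]
    {a : I → Γ} {b : J → Γ} (p : I → Prop) (q : J → Prop) [DecidablePred p] [DecidablePred q]
    {D : Matrix I J k} (hD : IsAdmissible a b D) (h : ∀ i j, D i j ≠ 0 → (p i ↔ q j)) :
    X.real a (a ∘ Subtype.val) (projMatrix k p) ≫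
        X.real (a ∘ Subtype.val) (b ∘ Subtype.val) (D.submatrix Subtype.val Subtype.val) =
      X.real a b D ≫ X.real b (b ∘ Subtype.val) (projMatrix k q) := by
  rw [X.real_comp hD (isAdmissible_projMatrix _ _), ← projMatrix_comm p q h,
    X.real_comp (isAdmissible_projMatrix _ _) (hD.submatrix _ _)]

/-- The inclusion of a block. -/
def blockIncl (h : K.IsBlock p₁ p₂ p₃) : X.complex h.restrict ⟶ X.complex K where
  τ₁ := X.real (K.a₁ ∘ Subtype.val) K.a₁ (inclMatrix k p₁)
  τ₂ := X.real (K.a₂ ∘ Subtype.val) K.a₂ (inclMatrix k p₂)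
  τ₃ := X.real (K.a₃ ∘ Subtype.val) K.a₃ (inclMatrix k p₃)
  comm₁₂ := X.real_incl_comm p₁ p₂ K.adm₁ h.block₁
  comm₂₃ := X.real_incl_comm p₂ p₃ K.adm₂ h.block₂

/-- The projection to a block. -/
def blockProj (h : K.IsBlock p₁ p₂ p₃) : X.complex K ⟶ X.complex h.restrict where
  τ₁ := X.real K.a₁ (K.a₁ ∘ Subtype.val) (projMatrix k p₁)
  τ₂ := X.real K.a₂ (K.a₂ ∘ Subtype.val) (projMatrix k p₂)
  τ₃ := X.real K.a₃ (K.a₃ ∘ Subtype.val) (projMatrix k p₃)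
  comm₁₂ := X.real_proj_comm p₁ p₂ K.adm₁ h.block₁
  comm₂₃ := X.real_proj_comm p₂ p₃ K.adm₂ h.block₂

lemma real_incl_proj {J : Type} [Fintype J] [DecidableEq J] (a : J → Γ) (p : J → Prop)
    [DecidablePred p] :
    X.real (a ∘ Subtype.val) a (inclMatrix k p) ≫ X.real a (a ∘ Subtype.val) (projMatrix k p)
      = 𝟙 _ := by
  rw [X.real_comp (isAdmissible_inclMatrix _ _) (isAdmissible_projMatrix _ _),
    inclMatrix_mul_projMatrix, X.real_one]

lemma real_incl_proj_of_disjoint {J : Type} [Fintype J] [DecidableEq J] (a : J → Γ)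
    (p q : J → Prop) [DecidablePred p] [DecidablePred q] (h : ∀ j, p j → ¬ q j) :
    X.real (a ∘ Subtype.val) a (inclMatrix k p) ≫ X.real a (a ∘ Subtype.val) (projMatrix k q)
      = 0 := by
  rw [X.real_comp (isAdmissible_inclMatrix _ _) (isAdmissible_projMatrix _ _),
    inclMatrix_mul_projMatrix_of_disjoint _ h, X.real_zero]

lemma real_proj_incl_add {J : Type} [Fintype J] [DecidableEq J] (a : J → Γ) (p : J → Prop)
    [DecidablePred p] :
    X.real a (a ∘ Subtype.val) (projMatrix k p) ≫ X.real (a ∘ Subtype.val) a (inclMatrix k p) +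
      X.real a (a ∘ Subtype.val) (projMatrix k (¬ p ·)) ≫
        X.real (a ∘ Subtype.val) a (inclMatrix k (¬ p ·)) = 𝟙 _ := by
  rw [X.real_comp (isAdmissible_projMatrix _ _) (isAdmissible_inclMatrix _ _),
    X.real_comp (isAdmissible_projMatrix _ _) (isAdmissible_inclMatrix _ _), ← X.real_add,
    projMatrix_mul_inclMatrix_add, X.real_one]

lemma blockIncl_blockProj (h : K.IsBlock p₁ p₂ p₃) : X.blockIncl h ≫ X.blockProj h = 𝟙 _ :=
  ShortComplex.hom_ext _ _ (X.real_incl_proj _ _) (X.real_incl_proj _ _) (X.real_incl_proj _ _)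

lemma blockIncl_blockProj_not (h : K.IsBlock p₁ p₂ p₃) :
    X.blockIncl h ≫ X.blockProj h.not = 0 :=
  ShortComplex.hom_ext _ _ (X.real_incl_proj_of_disjoint _ _ _ fun _ => not_not_intro)
    (X.real_incl_proj_of_disjoint _ _ _ fun _ => not_not_intro)
    (X.real_incl_proj_of_disjoint _ _ _ fun _ => not_not_intro)

lemma blockIncl_not_blockProj (h : K.IsBlock p₁ p₂ p₃) :
    X.blockIncl h.not ≫ X.blockProj h = 0 :=
  ShortComplex.hom_ext _ _ (X.real_incl_proj_of_disjoint _ _ _ fun _ => id)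
    (X.real_incl_proj_of_disjoint _ _ _ fun _ => id)
    (X.real_incl_proj_of_disjoint _ _ _ fun _ => id)

lemma blockProj_blockIncl_add (h : K.IsBlock p₁ p₂ p₃) :
    X.blockProj h ≫ X.blockIncl h + X.blockProj h.not ≫ X.blockIncl h.not = 𝟙 _ :=
  ShortComplex.hom_ext _ _ (X.real_proj_incl_add _ _) (X.real_proj_incl_add _ _)
    (X.real_proj_incl_add _ _)

/-- The homology of a block diagonal complex is the direct sum of the homologies of the blocks. -/
def homologyBlockIso [HasBinaryBiproducts 𝒜] [CategoryWithHomology 𝒜] (h : K.IsBlock p₁ p₂ p₃) :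
    (X.complex K).homology ≅ (X.complex h.restrict).homology ⊞ (X.complex h.not.restrict).homology
    where
  hom := biprod.lift (ShortComplex.homologyMap (X.blockProj h))
    (ShortComplex.homologyMap (X.blockProj h.not))
  inv := biprod.desc (ShortComplex.homologyMap (X.blockIncl h))
    (ShortComplex.homologyMap (X.blockIncl h.not))
  hom_inv_id := by
    rw [biprod.lift_desc, ← ShortComplex.homologyMap_comp, ← ShortComplex.homologyMap_comp,
      ← ShortComplex.homologyMap_add, X.blockProj_blockIncl_add, ShortComplex.homologyMap_id]
  inv_hom_id := by
    apply biprod.hom_ext <;> apply biprod.hom_ext' <;>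
    simp only [Category.assoc, biprod.lift_fst, biprod.lift_snd, biprod.inl_desc_assoc, biprod.inr_desc_assoc,
      ← ShortComplex.homologyMap_comp, blockIncl_blockProj, blockIncl_blockProj_not,
      blockIncl_not_blockProj, ShortComplex.homologyMap_id, ShortComplex.homologyMap_zero,
      Category.id_comp, biprod.inl_fst, biprod.inr_snd, biprod.inl_snd, biprod.inr_fst]

end Block

end RayDiagram

/-! ### Bars of a matrix complex -/

/-- A direct sum indexed by `Option ι` splits. -/
def biproductOptionIso {𝒜 : Type*} [Category 𝒜] [Preadditive 𝒜] [HasFiniteBiproducts 𝒜]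
    [HasBinaryBiproducts 𝒜] {ι : Type} [Fintype ι] (f : Option ι → 𝒜) :
    f none ⊞ (⨁ fun t => f (some t)) ≅ ⨁ f where
  hom := biprod.desc (biproduct.ι f none) (biproduct.desc fun t => biproduct.ι f (some t))
  inv := biproduct.desc fun t => match t with
    | none => biprod.inl
    | some t => biproduct.ι (fun t => f (some t)) t ≫ biprod.inr
  hom_inv_id := by
    apply biprod.hom_ext'
    · simp
    · apply biproduct.hom_ext'
      intro t
      simp
  inv_hom_id := by
    apply biproduct.hom_ext'
    rintro (_ | t) <;> simp

/-- The direct sum of a zero object and `Y` is `Y`. -/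
def biprodIsoOfIsZero {𝒜 : Type*} [Category 𝒜] [Preadditive 𝒜] [HasBinaryBiproducts 𝒜]
    {X Y : 𝒜} (h : IsZero X) : X ⊞ Y ≅ Y where
  hom := biprod.snd
  inv := biprod.inr
  hom_inv_id := by
    apply biprod.hom_ext'
    · exact h.eq_of_src _ _
    · simp

lemma exact_of_isZero_of_mono {𝒜 : Type*} [Category 𝒜] [Abelian 𝒜] (S : ShortComplex 𝒜)
    (h : IsZero S.X₁) (hg : Mono S.g) : IsZero S.homology :=
  S.exact_iff_isZero_homology.1 ((S.exact_iff_mono (h.eq_of_src _ _)).2 hg)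

/-- The homology of a complex `X₁ ⟶ X₂ ⟶ 0` is a cokernel. -/
def homologyIsoCokernelOfIsZero {𝒜 : Type*} [Category 𝒜] [Abelian 𝒜] (S : ShortComplex 𝒜)
    (h : IsZero S.X₃) : S.homology ≅ cokernel S.f :=
  have := S.isIso_homologyι (h.eq_of_tgt _ _)
  asIso S.homologyι ≪≫ S.opcyclesIsoCokernel

lemma isZero_biproduct {𝒜 : Type*} [Category 𝒜] [Preadditive 𝒜] [HasFiniteBiproducts 𝒜]
    {ι : Type} [Fintype ι] [IsEmpty ι] (f : ι → 𝒜) : IsZero (⨁ f) := by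
  rw [IsZero.iff_id_eq_zero]
  apply biproduct.hom_ext
  intro j
  exact isEmptyElim j

/-! ### Homology of the elementary blocks -/

namespace RayDiagram

variable {k Γ : Type*} [Field k] [LinearOrder Γ] {𝒜 : Type*} [Category 𝒜]

section Unique

variable [Preadditive 𝒜] [HasFiniteBiproducts 𝒜] (X : RayDiagram k Γ 𝒜)
  {I J : Type} [Fintype I] [Unique I] [Fintype J] [Unique J] (a : I → Γ) (b : J → Γ)

/-- A direct sum with one term. -/
def uniqueIso : (⨁ fun i => X.obj (a i)) ≅ X.obj (a default) where
  hom := biproduct.π _ default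
  inv := biproduct.ι (fun i => X.obj (a i)) default
  hom_inv_id := by
    apply biproduct.hom_ext'
    intro i
    rw [Unique.eq_default i]
    simp

/-- The morphism given by a matrix with one entry. -/
def realArrowIso (M : Matrix I J k) :
    Arrow.mk (X.real a b M) ≅ Arrow.mk (X.map (a default) (b default) (M default default)) :=
  Arrow.isoMk (X.uniqueIso a) (X.uniqueIso b) (by
    apply biproduct.hom_ext'
    intro i
    rw [Unique.eq_default i]
    simp [real, uniqueIso])

lemma mono_real {M : Matrix I J k} (h : b default ≤ a default) (hM : M default default ≠ 0) :
    Mono (X.real a b M) :=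
  have := X.mono_map_of_ne_zero h hM
  ((MorphismProperty.monomorphisms 𝒜).arrow_mk_iso_iff (X.realArrowIso a b M)).2 this

end Unique

variable [Abelian 𝒜] (X : RayDiagram k Γ 𝒜)

/-- The object attached to a bar with birth `b` and death `d`. -/
def bar (b : Γ) (d : WithTop Γ) : 𝒜 :=
  WithTop.recTopCoe (X.obj b) (fun d => cokernel (X.map d b 1)) d

/-- Rescaling a morphism does not change its cokernel. -/
def cokernelMapIso {b c : Γ} (h : c ≤ b) {s : k} (hs : s ≠ 0) :
    cokernel (X.map b c s) ≅ cokernel (X.map b c 1) :=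
  have := X.isIso_map_self b hs
  cokernel.mapIso _ _ (asIso (X.map b b s)) (Iso.refl _) (by
    simp [X.map_comp le_rfl h])

lemma isZero_cokernel_map_self (b : Γ) : IsZero (cokernel (X.map b b (1 : k))) := by
  rw [X.map_one]
  exact isZero_cokernel_of_epi _

/-- The homology of a complex with a single nonzero entry in the first matrix. -/
def homologyUniqueIso (K : MatrixComplex k Γ) [Unique K.J₁] [Unique K.J₂] [IsEmpty K.J₃]
    (h : K.D₁ default default ≠ 0) :
    (X.complex K).homology ≅ X.bar (K.a₂ default) (K.a₁ default) :=
  homologyIsoCokernelOfIsZero _ (isZero_biproduct _) ≪≫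
    (cokernel.mapIso _ _ ((Arrow.leftFunc).mapIso (X.realArrowIso K.a₁ K.a₂ K.D₁))
      ((Arrow.rightFunc).mapIso (X.realArrowIso K.a₁ K.a₂ K.D₁))
      (X.realArrowIso K.a₁ K.a₂ K.D₁).hom.w.symm) ≪≫
    X.cokernelMapIso (K.adm₁ _ _ h) h

lemma isZero_homology_of_unique (K : MatrixComplex k Γ) [IsEmpty K.J₁] [Unique K.J₂] [Unique K.J₃]
    (h : K.D₂ default default ≠ 0) : IsZero (X.complex K).homology :=
  exact_of_isZero_of_mono _ (isZero_biproduct _) (X.mono_real _ _ (K.adm₂ _ _ h) h)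

end RayDiagram

/-! ### Splitting off bars by induction on the number of generators -/

namespace MatrixComplex

variable {k Γ : Type*} [Field k] [LinearOrder Γ]

/-- A finite family of bars describes the homology of the complexes associated with `K`,
simultaneously in all abelian categories. -/
structure Bars.{v, w} {k Γ : Type*} [Field k] [LinearOrder Γ] (K : MatrixComplex k Γ) where
  /-- The index set. -/
  ι : Type
  [fin : Fintype ι]
  /-- The births. -/
  birth : ι → Γ
  /-- The deaths. -/
  death : ι → WithTop Γ
  lt : ∀ t, (birth t : WithTop Γ) < death t
  mem_birth : ∀ t, ∃ j, K.a₂ j = birth t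
  mem_death : ∀ t g, death t = (g : Γ) → ∃ j, K.a₁ j = g
  iso : ∀ (𝒜 : Type v) [Category.{w} 𝒜] [Abelian 𝒜] (X : RayDiagram k Γ 𝒜),
    Nonempty ((X.complex K).homology ≅ ⨁ fun t => X.bar (birth t) (death t))

attribute [instance] Bars.fin

/-- If both matrices vanish, there is one infinite bar for each generator. -/
lemma nonempty_bars_of_eq_zero.{v, w} (K : MatrixComplex k Γ) (h₁ : K.D₁ = 0) (h₂ : K.D₂ = 0) :
    Nonempty (Bars.{v, w} K) :=
  ⟨{ ι := K.J₂
     birth := K.a₂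
     death := fun _ => ⊤
     lt := fun _ => WithTop.coe_lt_top _
     mem_birth := fun t => ⟨t, rfl⟩
     mem_death := fun t g h => absurd h (WithTop.coe_ne_top).symm
     iso := fun 𝒜 _ _ X => by
       have e₁ : (X.complex K).f = 0 := by
         change X.real _ _ K.D₁ = 0
         rw [h₁, X.real_zero]
       have e₂ : (X.complex K).g = 0 := by
         change X.real _ _ K.D₂ = 0
         rw [h₂, X.real_zero]
       exact ⟨(ShortComplex.HomologyData.ofZeros (X.complex K) e₁ e₂).left.homologyIso⟩ }⟩

variable {K : MatrixComplex k Γ}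

/-- A block without homology contributes no bar, so the bars of the complementary block are those of
the whole. -/
lemma nonempty_bars_of_block_of_isZero.{v, w} {p₁ : K.J₁ → Prop} {p₂ : K.J₂ → Prop}
    {p₃ : K.J₃ → Prop} [DecidablePred p₁] [DecidablePred p₂] [DecidablePred p₃]
    (h : K.IsBlock p₁ p₂ p₃) (B : Bars.{v, w} h.not.restrict)
    (h0 : ∀ (𝒜 : Type v) [Category.{w} 𝒜] [Abelian 𝒜] (X : RayDiagram k Γ 𝒜),
      IsZero (X.complex h.restrict).homology) : Nonempty (Bars.{v, w} K) :=
  ⟨{ B with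
     mem_birth := fun t => (B.mem_birth t).imp' Subtype.val fun _ => id
     mem_death := fun t g e => (B.mem_death t g e).imp' Subtype.val fun _ => id
     iso := fun 𝒜 _ _ X => by
       obtain ⟨e⟩ := B.iso 𝒜 X
       exact ⟨X.homologyBlockIso h ≪≫ biprodIsoOfIsZero (h0 𝒜 X) ≪≫ e⟩ }⟩

/-- The block contributes a single bar, indexed by `none`, and the complementary block contributes
the others. -/
lemma nonempty_bars_of_block.{v, w} {p₁ : K.J₁ → Prop} {p₂ : K.J₂ → Prop}
    {p₃ : K.J₃ → Prop} [DecidablePred p₁] [DecidablePred p₂] [DecidablePred p₃]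
    (h : K.IsBlock p₁ p₂ p₃) (B : Bars.{v, w} h.not.restrict) (i : K.J₁) (j : K.J₂)
    (hij : K.a₂ j < K.a₁ i)
    (h0 : ∀ (𝒜 : Type v) [Category.{w} 𝒜] [Abelian 𝒜] (X : RayDiagram k Γ 𝒜),
      Nonempty ((X.complex h.restrict).homology ≅ X.bar (K.a₂ j) (K.a₁ i))) :
    Nonempty (Bars.{v, w} K) :=
  ⟨{ ι := Option B.ι
     birth := fun t => t.elim (K.a₂ j) B.birth
     death := fun t => t.elim (K.a₁ i) B.death
     lt := by
       rintro (_ | t)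
       · exact WithTop.coe_lt_coe.2 hij
       · exact B.lt t
     mem_birth := by
       rintro (_ | t)
       · exact ⟨j, rfl⟩
       · exact (B.mem_birth t).imp' Subtype.val fun _ => id
     mem_death := by
       rintro (_ | t) g e
       · exact ⟨i, WithTop.coe_injective e⟩
       · exact (B.mem_death t g e).imp' Subtype.val fun _ => id
     iso := fun 𝒜 _ _ X => by
       obtain ⟨e⟩ := B.iso 𝒜 X
       obtain ⟨e'⟩ := h0 𝒜 X
       exact ⟨X.homologyBlockIso h ≪≫ biprod.mapIso e' e ≪≫
         biproductOptionIso fun t : Option B.ι =>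
           X.bar (t.elim (K.a₂ j) B.birth) (t.elim (K.a₁ i) B.death)⟩ }⟩

lemma IsBlock.size_lt {p₁ : K.J₁ → Prop} {p₂ : K.J₂ → Prop}
    {p₃ : K.J₃ → Prop} [DecidablePred p₁] [DecidablePred p₂] [DecidablePred p₃]
    (h : K.IsBlock p₁ p₂ p₃) {j : K.J₂} (hj : p₂ j) : h.not.restrict.size < K.size := by
  have h₁ : Fintype.card {i // ¬ p₁ i} ≤ Fintype.card K.J₁ := Fintype.card_subtype_le _
  have h₃ : Fintype.card {i // ¬ p₃ i} ≤ Fintype.card K.J₃ := Fintype.card_subtype_le _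
  have h₂ : Fintype.card {i // ¬ p₂ i} < Fintype.card K.J₂ :=
    Fintype.card_subtype_lt (x := j) (not_not_intro hj)
  change Fintype.card {i // ¬ p₁ i} + Fintype.card {i // ¬ p₂ i} + Fintype.card {i // ¬ p₃ i} < _
  unfold size
  omega

/-- A change of bases keeps the gradings, hence the births and deaths, and changes the homology only
by an isomorphism. -/
lemma nonempty_bars_conj.{v, w} {P₁ P₁' : Matrix K.J₁ K.J₁ k} {P₂ P₂' : Matrix K.J₂ K.J₂ k}
    {P₃ P₃' : Matrix K.J₃ K.J₃ k}
    (h₁ : IsAdmissible K.a₁ K.a₁ P₁) (h₁' : IsAdmissible K.a₁ K.a₁ P₁')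
    (h₂ : IsAdmissible K.a₂ K.a₂ P₂) (h₂' : IsAdmissible K.a₂ K.a₂ P₂')
    (h₃ : IsAdmissible K.a₃ K.a₃ P₃) (h₃' : IsAdmissible K.a₃ K.a₃ P₃')
    (e₁ : P₁ * P₁' = 1) (e₁' : P₁' * P₁ = 1) (e₂ : P₂ * P₂' = 1) (e₂' : P₂' * P₂ = 1)
    (e₃ : P₃ * P₃' = 1) (e₃' : P₃' * P₃ = 1)
    (B : Nonempty (Bars.{v, w} (K.conj h₁ h₂ h₂' h₃' e₁' e₂' e₃'))) :
    Nonempty (Bars.{v, w} K) := by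
  obtain ⟨B⟩ := B
  exact ⟨{ B with
    iso := fun 𝒜 _ _ X => by
      obtain ⟨e⟩ := B.iso 𝒜 X
      exact ⟨ShortComplex.homologyMapIso
        (X.conjIso K h₁ h₁' h₂ h₂' h₃ h₃' e₁ e₁' e₂ e₂' e₃ e₃') ≪≫ e⟩ }⟩

/-- An isolated entry of the second matrix can be removed. -/
lemma nonempty_bars_of_isolated₂.{v, w} {i : K.J₂} {j : K.J₃} (hij : K.D₂ i j ≠ 0)
    (hD : ∀ i' j', K.D₂ i' j' ≠ 0 → (i' = i ↔ j' = j))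
    (ih : ∀ K' : MatrixComplex k Γ, K'.size < K.size → Nonempty (Bars.{v, w} K')) :
    Nonempty (Bars.{v, w} K) := by
  have h : K.IsBlock (fun _ => False) (· = i) (· = j) := by
    refine ⟨fun l i' hl => iff_of_false id fun hi => hl ?_, hD⟩
    subst hi
    -- Column `j` of `D₂` has only the entry at `i`, so the entry `(l, j)` of `D₁ * D₂ = 0` is `D₁ l
    -- i * D₂ i j`. Hence column `i` of `D₁` vanishes, and the pair `i`, `j` splits off with nothing
    -- in the first degree.
    have e := congrFun (congrFun K.mul_eq_zero l) j
    rw [Matrix.mul_apply, Finset.sum_eq_single i'] at e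
    · exact (_root_.mul_eq_zero.1 e).resolve_right hij
    · intro i'' _ hne
      rw [_root_.mul_eq_zero]
      right
      by_contra h'
      exact hne ((hD _ _ h').2 rfl)
    · simp
  obtain ⟨B⟩ := ih _ (h.size_lt (j := i) rfl)
  refine nonempty_bars_of_block_of_isZero h B fun 𝒜 _ _ X => ?_
  have : IsEmpty h.restrict.J₁ := ⟨fun x => x.2⟩
  let : Unique h.restrict.J₂ := Unique.subtypeEq i
  let : Unique h.restrict.J₃ := Unique.subtypeEq j
  exact X.isZero_homology_of_unique h.restrict hij

/-- If the second matrix is zero, an isolated entry of the first matrix can be removed. -/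
lemma nonempty_bars_of_isolated₁.{v, w} {i : K.J₁} {j : K.J₂} (h₂ : K.D₂ = 0)
    (hij : K.D₁ i j ≠ 0) (hD : ∀ i' j', K.D₁ i' j' ≠ 0 → (i' = i ↔ j' = j))
    (ih : ∀ K' : MatrixComplex k Γ, K'.size < K.size → Nonempty (Bars.{v, w} K')) :
    Nonempty (Bars.{v, w} K) := by
  have h : K.IsBlock (· = i) (· = j) (fun _ => False) :=
    ⟨hD, fun i' j' h' => absurd (congrFun (congrFun h₂ i') j') h'⟩
  obtain ⟨B⟩ := ih _ (h.size_lt (j := j) rfl)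
  let : Unique h.restrict.J₁ := Unique.subtypeEq i
  let : Unique h.restrict.J₂ := Unique.subtypeEq j
  have : IsEmpty h.restrict.J₃ := ⟨fun x => x.2⟩
  -- The homology of the block is the cokernel of a map between two rays. If the degrees agree, this
  -- map is an isomorphism and the would-be bar is empty; this keeps birth < death strict.
  rcases (K.adm₁ i j hij).lt_or_eq with hlt | heq
  · exact nonempty_bars_of_block h B i j hlt fun 𝒜 _ _ X =>
      ⟨X.homologyUniqueIso h.restrict hij⟩
  · refine nonempty_bars_of_block_of_isZero h B fun 𝒜 _ _ X =>
      IsZero.of_iso ?_ (X.homologyUniqueIso h.restrict hij)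
    change IsZero (cokernel (X.map (K.a₁ i) (K.a₂ j) 1))
    rw [heq]
    exact X.isZero_cokernel_map_self _

/-- The homology of a matrix complex is a finite sum of bars. -/
theorem nonempty_bars.{v, w} (K : MatrixComplex k Γ) : Nonempty (Bars.{v, w} K) := by
  induction hn : K.size using Nat.strong_induction_on generalizing K with
  | _ n ih =>
    subst hn
    have ih' : ∀ K' : MatrixComplex k Γ, K'.size < K.size → Nonempty (Bars.{v, w} K') :=
      fun K' h => ih _ h K' rfl
    -- The second matrix is reduced first, since the relation `D₁ * D₂ = 0` then clears the matching
    -- column of `D₁`. Once `D₂` is zero, every change of bases used to reduce `D₁` keeps it zero.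
    by_cases h₂ : K.D₂ = 0
    · by_cases h₁ : K.D₁ = 0
      · exact K.nonempty_bars_of_eq_zero h₁ h₂
      · obtain ⟨i, j, P, P', Q, Q', hP, hP', hQ, hQ', e₁, e₂, e₃, e₄, hij, hD⟩ :=
          exists_pivot K.a₁ K.a₂ h₁
        refine nonempty_bars_conj hP hP' hQ' hQ IsAdmissible.one IsAdmissible.one e₁ e₂ e₄ e₃
          (mul_one 1) (mul_one 1) (nonempty_bars_of_isolated₁ (i := i) (j := j) ?_ hij hD ih')
        have : Q' * K.D₂ * (1 : Matrix K.J₃ K.J₃ k) = 0 := by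
          rw [h₂, Matrix.mul_zero, Matrix.zero_mul]
        exact this
    · obtain ⟨i, j, P, P', Q, Q', hP, hP', hQ, hQ', e₁, e₂, e₃, e₄, hij, hD⟩ :=
        exists_pivot K.a₂ K.a₃ h₂
      exact nonempty_bars_conj IsAdmissible.one IsAdmissible.one hP hP' hQ' hQ (mul_one 1)
        (mul_one 1) e₁ e₂ e₄ e₃ (nonempty_bars_of_isolated₂ (i := i) (j := j) hij hD ih')

end MatrixComplex

/-! ### Uniqueness of multiplicities in direct sums -/

section Multiplicity

/-- The identity of size `p` has rank `p`, and it factors through dimension `q`. -/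
lemma le_of_matrix_mul_eq_one {k : Type*} [Field k] {p q : ℕ} (M : Matrix (Fin p) (Fin q) k)
    (N : Matrix (Fin q) (Fin p) k) (h : M * N = 1) : p ≤ q := by
  have h1 : (M * N).rank = p := by simp [h]
  have h2 := (Matrix.rank_mul_le_left M N).trans (Matrix.rank_le_width M)
  omega

variable {k : Type*} [Field k] {𝒞 : Type*} [Category 𝒞] [Preadditive 𝒞] {α : Type*}
  (X : α → 𝒞) {B C : α → ℕ}

open Classical in
/-- A morphism from a coproduct to an object to which only finitely many terms map nontrivially
factors through finitely many terms. -/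
lemma sum_sigma_π_ι_comp [HasCoproduct fun b : Bars B => X b.1] (S : Finset (Bars B)) {T : 𝒞}
    (hS : ∀ b, b ∉ S → ∀ f : X b.1 ⟶ T, f = 0) (h : (∐ fun b : Bars B => X b.1) ⟶ T) :
    h = ∑ b ∈ S, Sigma.π (fun b : Bars B => X b.1) b ≫ Sigma.ι (fun b : Bars B => X b.1) b ≫ h := by
  classical
  apply Sigma.hom_ext
  intro c
  rw [Preadditive.comp_sum]
  by_cases hc : c ∈ S
  · rw [Finset.sum_eq_single c]
    · rw [Sigma.ι_π_eq_id_assoc]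
    · intro b _ hb
      rw [Sigma.ι_π_of_ne_assoc _ hb.symm, zero_comp]
    · exact fun h' => absurd hc h'
  · rw [hS c hc (Sigma.ι (fun b : Bars B => X b.1) c ≫ h)]
    refine (Finset.sum_eq_zero fun b hb => ?_).symm
    have hcb : c ≠ b := by
      rintro rfl
      exact hc hb
    rw [Sigma.ι_π_of_ne_assoc _ hcb, zero_comp]

/-- The multiplicity of `X I` in a direct sum is at most its multiplicity in an isomorphic direct
sum. The scalar of an endomorphism of `X I` is supposed to be determined after composition with a
morphism `ev` to an object `T`, to which only finitely many of the `X J` map nontrivially. -/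
lemma multiplicity_le [HasCoproduct fun b : Bars B => X b.1] [HasCoproduct fun b : Bars C => X b.1]
    (e : (∐ fun b : Bars B => X b.1) ≅ ∐ fun b : Bars C => X b.1) (I : α)
    (coeff : (X I ⟶ X I) →+ k) (hone : coeff (𝟙 _) = 1)
    (hmul : ∀ f g, coeff (f ≫ g) = coeff f * coeff g)
    (hne : ∀ J, C J ≠ 0 → J ≠ I → ∀ (f : X I ⟶ X J) (g : X J ⟶ X I), coeff (f ≫ g) = 0)
    {T : 𝒞} (ev : X I ⟶ T) (hev : ∀ f, f ≫ ev = 0 → coeff f = 0)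
    (hfin : {J | C J ≠ 0 ∧ ∃ f : X J ⟶ T, f ≠ 0}.Finite) : B I ≤ C I := by
  classical
  let XB := fun b : Bars B => X b.1
  let XC := fun b : Bars C => X b.1
  let F : Fin (C I) ↪ Bars C := ⟨fun j => ⟨I, j⟩, fun j j' h => by cases h; rfl⟩
  -- The copies of `X I` are added explicitly, so that they need not be shown to map nontrivially to
  -- `T`.
  let S : Finset (Bars C) := (hfin.toFinset.sigma fun _ => Finset.univ) ∪ Finset.univ.map F
  have hS : ∀ c, c ∉ S → ∀ f : XC c ⟶ T, f = 0 := by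
    intro c hc f
    by_contra hf
    refine hc (Finset.mem_union_left _ (Finset.mem_sigma.2 ⟨?_, Finset.mem_univ _⟩))
    rw [Set.Finite.mem_toFinset]
    exact ⟨fun h0 => (Fin.cast h0 c.2).elim0, f, hf⟩
  -- An endomorphism of `X I` that factors through the direct sum has as its scalar the sum of the
  -- contributions of the copies of `X I` alone.
  have key : ∀ (g : X I ⟶ ∐ XC) (h : (∐ XC) ⟶ X I), coeff (g ≫ h) =
      ∑ j, coeff (g ≫ Sigma.π XC (F j)) * coeff (Sigma.ι XC (F j) ≫ h) := by
    intro g h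
    have h1 : coeff (g ≫ h) =
        coeff (∑ c ∈ S, (g ≫ Sigma.π XC c) ≫ (Sigma.ι XC c ≫ h)) := by
      -- The infinite direct sum need not be a finite sum of its projections, but it becomes one
      -- after composition with `ev`; by `hev` the scalar does not see the difference.
      rw [← sub_eq_zero, ← map_sub]
      apply hev
      rw [Preadditive.sub_comp, sub_eq_zero, Category.assoc,
        sum_sigma_π_ι_comp X S hS (h ≫ ev), Preadditive.comp_sum, Preadditive.sum_comp]
      simp only [Category.assoc]
      rfl
    rw [h1, map_sum, ← Finset.sum_subset Finset.subset_union_right, Finset.sum_map]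
    · exact Finset.sum_congr rfl fun j _ => hmul _ _
    · rintro ⟨J, j⟩ _ hc
      refine hne J (fun h0 => (Fin.cast h0 j).elim0) ?_ _ _
      rintro rfl
      exact hc (Finset.mem_map_of_mem F (Finset.mem_univ j))
  -- The matrices consist of the scalars of `e.hom` and `e.inv` between the copies of `X I`. By
  -- `key` their product is the matrix of scalars of `ι ≫ π` in the first direct sum, which is the
  -- identity.
  refine le_of_matrix_mul_eq_one
    (Matrix.of fun i j => coeff (Sigma.ι XB ⟨I, i⟩ ≫ e.hom ≫ Sigma.π XC (F j)))
    (Matrix.of fun j i => coeff (Sigma.ι XC (F j) ≫ e.inv ≫ Sigma.π XB ⟨I, i⟩)) ?_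
  ext i i'
  rw [Matrix.mul_apply]
  have := key (Sigma.ι XB ⟨I, i⟩ ≫ e.hom) (e.inv ≫ Sigma.π XB ⟨I, i'⟩)
  simp only [Category.assoc, Iso.hom_inv_id_assoc] at this
  simp only [Matrix.of_apply, ← this]
  by_cases hi : i = i'
  · subst hi
    rw [Sigma.ι_π_eq_id, hone, Matrix.one_apply_eq]
  · rw [Sigma.ι_π_of_ne _ (fun h => hi (by cases h; rfl)), map_zero, Matrix.one_apply_ne hi]

end Multiplicity

/-! ### Multisets given by finite families -/

section Family

variable {ι α : Type*} [Finite ι] (f : ι → α)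

/-- The multiplicity function of a finite family. -/
def multiplicity (x : α) : ℕ := Nat.card {t // f t = x}

/-- The elements of the multiset of values of a family are the indices of the family. -/
def barsMultiplicityEquiv : Bars (multiplicity f) ≃ ι :=
  (Equiv.sigmaCongrRight fun _ => (Finite.equivFin _).symm).trans
    (Equiv.sigmaFiberEquiv f)

lemma apply_barsMultiplicityEquiv (b : Bars (multiplicity f)) :
    f (barsMultiplicityEquiv f b) = b.1 :=
  ((Finite.equivFin _).symm b.2 : {t // f t = b.1}).2

end Family

lemma exists_of_multiplicity_ne_zero {ι α : Type*} (f : ι → α) {x : α} (h : multiplicity f x ≠ 0) : ∃ t, f t = x := by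
  obtain ⟨⟨t⟩, -⟩ := Nat.card_ne_zero.1 h
  exact ⟨t.1, t.2⟩

/-- A direct sum over a finite family is the direct sum over the corresponding multiset. -/
lemma nonempty_biproduct_iso_sigma {𝒞 : Type*} [Category 𝒞] [Preadditive 𝒞]
    [HasFiniteBiproducts 𝒞] {α : Type*} (X : α → 𝒞) {ι : Type} [Fintype ι] (f : ι → α) (Y : ι → 𝒞)
    (e : ∀ t, Nonempty (Y t ≅ X (f t)))
    [HasCoproduct fun b : Bars (multiplicity f) => X b.1] :
    Nonempty ((⨁ Y) ≅ ∐ fun b : Bars (multiplicity f) => X b.1) := by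
  let σ := barsMultiplicityEquiv f
  have h : ∀ b, Nonempty (X b.1 ≅ Y (σ b)) := fun b => by
    obtain ⟨e⟩ := e (σ b)
    exact ⟨eqToIso (by rw [← apply_barsMultiplicityEquiv f b]) ≪≫ e.symm⟩
  exact ⟨(biproduct.isoCoproduct Y) ≪≫
    (Sigma.whiskerEquiv σ fun b => (h b).some.symm).symm⟩

/-! ### Morphisms between the sheaves `k_Z` -/

section SheafOn

variable {k : Type u} [Field k] {X : TopCat.{u}} {Z W : Set X}

/-- The restriction of sections. -/
def secRes {U V : Opens X} (h : V ≤ U) : sectionsOn k Z U →ₗ[k] sectionsOn k Z V where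
  toFun f := ⟨fun x => f.1 ⟨x.1, h x.2⟩, sectionsOn_restrict h f.2⟩
  map_add' _ _ := rfl
  map_smul' _ _ := rfl

/-- The action on sections of a morphism of sheaves to `k_W`. -/
def secMap {F : TopCat.Sheaf (ModuleCat.{u} k) X} (φ : F ⟶ sheafOn k X W) (U : Opens X) :
    F.obj.obj (op U) →ₗ[k] sectionsOn k W U :=
  (φ.hom.app (op U)).hom

lemma secMap_map {F : TopCat.Sheaf (ModuleCat.{u} k) X} (φ : F ⟶ sheafOn k X W) {U V : Opens X}
    (h : V ≤ U) (t : F.obj.obj (op U)) :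
    secMap φ V ((F.obj.map (homOfLE h).op).hom t) = secRes h (secMap φ U t) :=
  congrArg (fun g => g.hom t) (φ.hom.naturality (homOfLE h).op)

/-- The action on sections of a morphism `k_Z ⟶ k_W`. -/
def secApp (φ : sheafOn k X Z ⟶ sheafOn k X W) (U : Opens X) :
    sectionsOn k Z U →ₗ[k] sectionsOn k W U :=
  (φ.hom.app (op U)).hom

lemma secApp_secRes (φ : sheafOn k X Z ⟶ sheafOn k X W) {U V : Opens X} (h : V ≤ U)
    (s : sectionsOn k Z U) : secApp φ V (secRes h s) = secRes h (secApp φ U s) :=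
  secMap_map φ h s

lemma sheafOn_hom_ext {φ ψ : sheafOn k X Z ⟶ sheafOn k X W}
    (h : ∀ U s, secApp φ U s = secApp ψ U s) : φ = ψ := by
  apply Sheaf.hom_ext
  apply NatTrans.ext
  funext U
  apply ModuleCat.hom_ext
  apply LinearMap.ext
  exact h U.unop

/-- A section of `k_Z` vanishing at a point vanishes near this point. -/
lemma exists_secRes_eq_zero {U : Opens X} (s : sectionsOn k Z U) {x : X} (hx : x ∈ U)
    (h0 : s.1 ⟨x, hx⟩ = 0) : ∃ (V : Opens X) (h : V ≤ U), x ∈ V ∧ secRes h s = 0 := by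
  have hev : ∀ᶠ y in 𝓝 (⟨x, hx⟩ : U), s.1 y = 0 := by
    have := s.2.2.2.isOpen_compl.mem_nhds (x := ⟨x, hx⟩) (by simp [h0])
    filter_upwards [this] with y hy
    simpa using hy
  obtain ⟨t, hts, ht, hxt⟩ := eventually_nhds_iff.1 hev
  refine ⟨⟨Subtype.val '' t, U.isOpen.isOpenEmbedding_subtypeVal.isOpenMap t ht⟩, ?_,
    ⟨⟨x, hx⟩, hxt, rfl⟩, ?_⟩
  · rintro _ ⟨y, -, rfl⟩
    exact y.2
  · ext ⟨_, y, hy, rfl⟩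
    exact hts y hy

/-- A morphism of sheaves acts on germs, and a section that vanishes at `x` has zero germ there
because its support is closed. Hence the value of an image at `x` depends only on the value of the
section at `x`. -/
lemma secApp_eq_zero (φ : sheafOn k X Z ⟶ sheafOn k X W) {U : Opens X} (s : sectionsOn k Z U)
    {x : X} (hx : x ∈ U) (h0 : s.1 ⟨x, hx⟩ = 0) : (secApp φ U s).1 ⟨x, hx⟩ = 0 := by
  obtain ⟨V, h, hxV, e⟩ := exists_secRes_eq_zero s hx h0
  have : (secRes h (secApp φ U s)).1 ⟨x, hxV⟩ = 0 := by
    rw [← secApp_secRes, e, map_zero]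
    rfl
  exact this

lemma secApp_congr (φ : sheafOn k X Z ⟶ sheafOn k X W) {U V : Opens X} (s : sectionsOn k Z U)
    (t : sectionsOn k Z V) {x : X} (hx : x ∈ U) (hx' : x ∈ V)
    (h : s.1 ⟨x, hx⟩ = t.1 ⟨x, hx'⟩) :
    (secApp φ U s).1 ⟨x, hx⟩ = (secApp φ V t).1 ⟨x, hx'⟩ := by
  have hl : U ⊓ V ≤ U := inf_le_left
  have hr : U ⊓ V ≤ V := inf_le_right
  have := secApp_eq_zero φ (secRes hl s - secRes hr t) (x := x) ⟨hx, hx'⟩ (sub_eq_zero.2 h)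
  rw [map_sub, secApp_secRes, secApp_secRes] at this
  exact sub_eq_zero.1 this

/-- There is a section of `k_Z` taking the value `1` at `x`. -/
def HasUnitAt (k : Type u) [Field k] (Z : Set X) (x : X) : Prop :=
  ∃ (U : Opens X) (hx : x ∈ U) (s : sectionsOn k Z U), s.1 ⟨x, hx⟩ = 1

lemma HasUnitAt.mem {x : X} (h : HasUnitAt k Z x) : x ∈ Z := by
  obtain ⟨U, hx, s, hs⟩ := h
  by_contra hZ
  rw [s.2.1 ⟨x, hx⟩ hZ] at hs
  exact zero_ne_one hs

lemma hasUnitAt_of_ne_zero {U : Opens X} (s : sectionsOn k Z U) {x : X} (hx : x ∈ U)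
    (h : s.1 ⟨x, hx⟩ ≠ 0) : HasUnitAt k Z x :=
  ⟨U, hx, (s.1 ⟨x, hx⟩)⁻¹ • s, inv_mul_cancel₀ h⟩

open Classical in
/-- The scalar by which a morphism `k_Z ⟶ k_W` acts at a point. -/
def coeffAt (x : X) (φ : sheafOn k X Z ⟶ sheafOn k X W) : k :=
  if h : HasUnitAt k Z x then
    (secApp φ h.choose h.choose_spec.choose_spec.choose).1 ⟨x, h.choose_spec.choose⟩ else 0

lemma coeffAt_eq {x : X} (φ : sheafOn k X Z ⟶ sheafOn k X W) {U : Opens X} (hx : x ∈ U)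
    (s : sectionsOn k Z U) (hs : s.1 ⟨x, hx⟩ = 1) : coeffAt x φ = (secApp φ U s).1 ⟨x, hx⟩ := by
  have h : HasUnitAt k Z x := ⟨U, hx, s, hs⟩
  rw [coeffAt, dif_pos h]
  apply secApp_congr
  rw [hs]
  exact h.choose_spec.choose_spec.choose_spec

/-- The stalks of `k_Z` have dimension at most one, so a morphism is multiplication by a function `x
↦ coeffAt x φ`. All later computations with morphisms go through this function. -/
lemma secApp_apply (φ : sheafOn k X Z ⟶ sheafOn k X W) {U : Opens X} (s : sectionsOn k Z U)
    (x : U) : (secApp φ U s).1 x = coeffAt x.1 φ * s.1 x := by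
  by_cases h : s.1 x = 0
  · rw [secApp_eq_zero φ s x.2 h, h, mul_zero]
  · obtain ⟨V, hx, t, ht⟩ := hasUnitAt_of_ne_zero s x.2 h
    rw [coeffAt_eq φ hx t ht, secApp_congr φ s (s.1 x • t) x.2 hx, map_smul, mul_comm]
    · rfl
    · change s.1 x = s.1 x * t.1 _
      rw [ht, mul_one]

lemma coeffAt_add (x : X) (φ ψ : sheafOn k X Z ⟶ sheafOn k X W) :
    coeffAt x (φ + ψ) = coeffAt x φ + coeffAt x ψ := by
  by_cases h : HasUnitAt k Z x
  · obtain ⟨U, hx, s, hs⟩ := h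
    rw [coeffAt_eq _ hx s hs, coeffAt_eq _ hx s hs, coeffAt_eq _ hx s hs]
    rfl
  · simp [coeffAt, h]

lemma coeffAt_zero (x : X) : coeffAt x (0 : sheafOn k X Z ⟶ sheafOn k X W) = 0 :=
  map_zero (AddMonoidHom.mk' (coeffAt x) (coeffAt_add x))

lemma coeffAt_comp {Y : Set X} (x : X) (φ : sheafOn k X Z ⟶ sheafOn k X W)
    (ψ : sheafOn k X W ⟶ sheafOn k X Y) : coeffAt x (φ ≫ ψ) = coeffAt x φ * coeffAt x ψ := by
  by_cases h : HasUnitAt k Z x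
  · obtain ⟨U, hx, s, hs⟩ := h
    rw [coeffAt_eq (φ ≫ ψ) hx s hs]
    have : secApp (φ ≫ ψ) U s = secApp ψ U (secApp φ U s) := rfl
    rw [this, secApp_apply, secApp_apply, hs]
    ring
  · simp [coeffAt, h]

lemma coeffAt_id {x : X} (h : HasUnitAt k Z x) : coeffAt x (𝟙 (sheafOn k X Z)) = 1 := by
  obtain ⟨U, hx, s, hs⟩ := h
  rw [coeffAt_eq _ hx s hs]
  exact hs

lemma coeffAt_eq_zero_of_notMem {x : X} (φ : sheafOn k X Z ⟶ sheafOn k X W) (h : x ∉ W) :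
    coeffAt x φ = 0 := by
  by_cases h' : HasUnitAt k Z x
  · obtain ⟨U, hx, s, hs⟩ := h'
    rw [coeffAt_eq _ hx s hs]
    exact (secApp φ U s).2.1 _ h
  · simp [coeffAt, h']

lemma sheafOn_hom_ext_coeffAt {φ ψ : sheafOn k X Z ⟶ sheafOn k X W}
    (h : ∀ x ∈ Z, coeffAt x φ = coeffAt x ψ) : φ = ψ := by
  apply sheafOn_hom_ext
  intro U s
  ext x
  rw [secApp_apply, secApp_apply]
  by_cases hx : x.1 ∈ Z
  · rw [h _ hx]
  · rw [s.2.1 x hx, mul_zero, mul_zero]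

/-- Near `x` a section with value `1` at `x` is constant on `Z`, and its image is constant on `W`;
their ratio is the scalar. -/
lemma coeffAt_eventually_eq {x : X} (h : HasUnitAt k Z x) (hW : x ∈ W)
    (φ : sheafOn k X Z ⟶ sheafOn k X W) :
    ∀ᶠ y in 𝓝 x, y ∈ Z → y ∈ W → coeffAt y φ = coeffAt x φ := by
  have hZ := h.mem
  obtain ⟨U, hx, s, hs⟩ := h
  have h1 := s.2.2.1 ⟨x, hx⟩ hZ
  have h2 := (secApp φ U s).2.2.1 ⟨x, hx⟩ hW
  rw [nhds_subtype_eq_comap, Filter.eventually_comap] at h1 h2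
  filter_upwards [h1, h2, U.isOpen.mem_nhds hx] with y h1 h2 hy hyZ hyW
  have e1 := h1 ⟨y, hy⟩ rfl hyZ
  have e2 := h2 ⟨y, hy⟩ rfl hyW
  rw [secApp_apply, secApp_apply, e1, hs, mul_one, mul_one] at e2
  exact e2

/-- The scalar is locally constant on `Z ∩ W`, hence constant when this set is preconnected. -/
lemma coeffAt_eq_coeffAt (hZ : ∀ x ∈ Z, HasUnitAt k Z x) (hp : IsPreconnected (Z ∩ W))
    (φ : sheafOn k X Z ⟶ sheafOn k X W) {x y : X} (hx : x ∈ Z ∩ W) (hy : y ∈ Z ∩ W) :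
    coeffAt x φ = coeffAt y φ := by
  have : PreconnectedSpace (Z ∩ W : Set X) := isPreconnected_iff_preconnectedSpace.1 hp
  have hlc : IsLocallyConstant fun z : (Z ∩ W : Set X) => coeffAt z.1 φ := by
    rw [IsLocallyConstant.iff_eventually_eq]
    intro z
    have := continuous_subtype_val.continuousAt.eventually
      (coeffAt_eventually_eq (hZ _ z.2.1) z.2.2 φ)
    filter_upwards [this] with w hw
    exact hw w.2.1 w.2.2
  exact hlc.apply_eq_of_preconnectedSpace ⟨x, hx⟩ ⟨y, hy⟩

/-- A composite `k_Z ⟶ k_W ⟶ k_Z` with `W ≠ Z` vanishes, if `Z`, `W` and `Z ∩ W` are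
connected. -/
lemma coeffAt_comp_eq_zero (hZ : ∀ x ∈ Z, HasUnitAt k Z x) (hW : ∀ x ∈ W, HasUnitAt k W x)
    (hZp : IsPreconnected Z) (hWp : IsPreconnected W) (hne : W ≠ Z)
    (φ : sheafOn k X Z ⟶ sheafOn k X W) (ψ : sheafOn k X W ⟶ sheafOn k X Z) {x : X}
    (hx : x ∈ Z) : coeffAt x (φ ≫ ψ) = 0 := by
  by_cases hxW : x ∈ W
  · by_cases h : Z ⊆ W
    · obtain ⟨y, hyW, hyZ⟩ : ∃ y ∈ W, y ∉ Z := by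
        by_contra! h'
        exact hne (Set.Subset.antisymm h' h)
      -- When `Z ⊂ W` the composite in the other order is used: it has the same scalar at `x`, this
      -- scalar is constant on `W`, and it vanishes at a point `y` outside `Z`.
      rw [coeffAt_comp, mul_comm, ← coeffAt_comp, coeffAt_eq_coeffAt hW (by simpa using hWp) (ψ ≫ φ)
        ⟨hxW, hxW⟩ ⟨hyW, hyW⟩, coeffAt_comp, coeffAt_eq_zero_of_notMem ψ hyZ, zero_mul]
    · obtain ⟨y, hyZ, hyW⟩ := Set.not_subset.1 h
      rw [coeffAt_eq_coeffAt hZ (by simpa using hZp) (φ ≫ ψ)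
        ⟨hx, hx⟩ ⟨hyZ, hyZ⟩, coeffAt_comp, coeffAt_eq_zero_of_notMem φ hyW, zero_mul]
  · rw [coeffAt_comp, coeffAt_eq_zero_of_notMem φ hxW, zero_mul]

/-! ### Extension and restriction -/

/-- The morphism `k_Z ⟶ k_W` given by a scalar, for an open subset `Z` of `W`. -/
def extendHom (hZ : IsOpen Z) (h : Z ⊆ W) (c : k) : sheafOn k X Z ⟶ sheafOn k X W :=
  ⟨{app U := ModuleCat.ofHom ((LinearMap.lsmul k (U.unop → k) c).restrict (p := sectionsOn k Z U.unop)
        (q := sectionsOn k W U.unop) (by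
      intro f hf
      apply Submodule.smul_mem
      refine ⟨fun x hx => hf.1 x fun hx' => hx (h hx'), fun x hx => ?_, hf.2.2⟩
      by_cases hxZ : x.1 ∈ Z
      · filter_upwards [hf.2.1 x hxZ, (hZ.preimage continuous_subtype_val).mem_nhds hxZ]
          with y hy hyZ _
        exact hy hyZ
      · have h0 := hf.1 x hxZ
        filter_upwards [hf.2.2.isOpen_compl.mem_nhds (x := x) (by simp [h0])] with y hy _
        rw [h0]
        simpa using hy))
    naturality _ _ _ := rfl}⟩

lemma secApp_extendHom (hZ : IsOpen Z) (h : Z ⊆ W) (c : k) {U : Opens X} (s : sectionsOn k Z U)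
    (x : U) : (secApp (extendHom hZ h c) U s).1 x = c * s.1 x := rfl

lemma mono_extendHom (hZ : IsOpen Z) (h : Z ⊆ W) {c : k} (hc : c ≠ 0) :
    Mono (extendHom (k := k) hZ h c) := by
  refine ⟨fun {F} φ ψ e => ?_⟩
  apply Sheaf.hom_ext
  apply NatTrans.ext
  funext U
  apply ModuleCat.hom_ext
  apply LinearMap.ext
  intro t
  apply Subtype.ext
  funext x
  have : c * (secMap φ U.unop t).1 x = c * (secMap ψ U.unop t).1 x :=
    congrArg (fun φ : F ⟶ sheafOn k X W => (secMap φ U.unop t).1 x) e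
  exact mul_left_cancel₀ hc this

open Classical in
/-- The restriction `k_W ⟶ k_{W ∩ C}` to a closed subset. -/
def restrictHom (k : Type u) [Field k] (W : Set X) {C : Set X} (hC : IsClosed C) :
    sheafOn k X W ⟶ sheafOn k X (W ∩ C) :=
  ⟨{app U := ModuleCat.ofHom
      { toFun f := ⟨fun x => if x.1 ∈ C then f.1 x else 0, by
          obtain ⟨h1, h2, h3⟩ := f.2
          refine ⟨fun x hx => ?_, fun x hx => ?_, ?_⟩
          · by_cases hxC : x.1 ∈ C
            · exact (if_pos hxC).trans (h1 x fun hW => hx ⟨hW, hxC⟩)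
            · exact if_neg hxC
          · filter_upwards [h2 x hx.1] with y hy hyW
            rw [if_pos hx.2, if_pos hyW.2]
            exact hy hyW.1
          · have : {x : U.unop | (if x.1 ∈ C then f.1 x else 0) ≠ 0}
                = {x | x.1 ∈ C} ∩ {x | f.1 x ≠ 0} := by
              ext x
              simp
            rw [this]
            exact (hC.preimage continuous_subtype_val).inter h3⟩
        map_add' f g := by
          apply Subtype.ext
          funext x
          change (if x.1 ∈ C then f.1 x + g.1 x else 0)
            = (if x.1 ∈ C then f.1 x else 0) + if x.1 ∈ C then g.1 x else 0
          split_ifs <;> simp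
        map_smul' c f := by
          apply Subtype.ext
          funext x
          change (if x.1 ∈ C then c * f.1 x else 0) = c * if x.1 ∈ C then f.1 x else 0
          split_ifs <;> simp }
    naturality _ _ _ := rfl}⟩

lemma secApp_restrictHom {C : Set X} (hC : IsClosed C) {U : Opens X} (s : sectionsOn k W U)
    (x : U) (hx : x.1 ∈ C) : (secApp (restrictHom k W hC) U s).1 x = s.1 x :=
  if_pos hx

lemma secApp_restrictHom_of_notMem {C : Set X} (hC : IsClosed C) {U : Opens X}
    (s : sectionsOn k W U) (x : U) (hx : x.1 ∉ C) : (secApp (restrictHom k W hC) U s).1 x = 0 :=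
  if_neg hx

lemma coeffAt_comp_restrictHom {C : Set X} (hC : IsClosed C) {x : X} (hx : x ∈ C)
    (φ : sheafOn k X Z ⟶ sheafOn k X W) : coeffAt x (φ ≫ restrictHom k W hC) = coeffAt x φ := by
  by_cases h : HasUnitAt k Z x
  · obtain ⟨U, hxU, s, hs⟩ := h
    rw [coeffAt_eq _ hxU s hs, coeffAt_eq _ hxU s hs]
    exact secApp_restrictHom hC _ _ hx
  · simp [coeffAt, h]

lemma extendHom_restrictHom (hW : IsOpen W) {C : Set X} (hC : IsClosed C) :
    extendHom (k := k) (hW.sdiff hC) Set.sdiff_subset 1 ≫ restrictHom k W hC = 0 := by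
  apply sheafOn_hom_ext
  intro U s
  apply Subtype.ext
  funext x
  let t : sectionsOn k W U := secApp (extendHom (k := k) (hW.sdiff hC) Set.sdiff_subset 1) U s
  change (secApp (restrictHom k W hC) U t).1 x = 0
  by_cases hx : x.1 ∈ C
  · rw [secApp_restrictHom _ _ _ hx, secApp_extendHom, s.2.1 x fun h => h.2 hx, mul_zero]
  · exact secApp_restrictHom_of_notMem _ _ _ hx

lemma secMap_mem_of_comp_eq_zero {C : Set X} (hC : IsClosed C)
    {F : TopCat.Sheaf (ModuleCat.{u} k) X} (g : F ⟶ sheafOn k X W)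
    (hg : g ≫ restrictHom k W hC = 0) (U : Opens X) (t : F.obj.obj (op U)) :
    (secMap g U t).1 ∈ sectionsOn k (W \ C) U := by
  have h0 : ∀ x : U, x.1 ∈ C → (secMap g U t).1 x = 0 := by
    intro x hx
    rw [← secApp_restrictHom hC _ x hx]
    exact congrArg (fun φ : F ⟶ sheafOn k X (W ∩ C) => (secMap φ U t).1 x) hg
  obtain ⟨h1, h2, h3⟩ := (secMap g U t).2
  refine ⟨fun x hx => ?_, fun x hx => ?_, h3⟩
  · by_cases hxC : x.1 ∈ C
    · exact h0 x hxC
    · exact h1 x fun h => hx ⟨h, hxC⟩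
  · filter_upwards [h2 x hx.1] with y hy hyW
    exact hy hyW.1

/-- The factorization through `k_{W \ C}` of a morphism to `k_W` that vanishes on `C`. -/
def liftExtendHom {C : Set X} (hC : IsClosed C)
    {F : TopCat.Sheaf (ModuleCat.{u} k) X} (g : F ⟶ sheafOn k X W)
    (hg : g ≫ restrictHom k W hC = 0) : F ⟶ sheafOn k X (W \ C) :=
  ⟨{ app U := ModuleCat.ofHom (((sectionsOn k W U.unop).subtype ∘ₗ secMap g U.unop).codRestrict
        (sectionsOn k (W \ C) U.unop) (secMap_mem_of_comp_eq_zero hC g hg U.unop))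
     naturality U V i := by
      apply ModuleCat.hom_ext
      apply LinearMap.ext
      intro t
      apply Subtype.ext
      have := congrArg Subtype.val (secMap_map g i.unop.le t)
      exact this }⟩

/-- The kernel of `k_W ⟶ k_{W ∩ C}` is `k_{W \ C}`, for `W` open and `C` closed. -/
def isKernelExtendHom (hW : IsOpen W) {C : Set X} (hC : IsClosed C) :
    IsLimit (KernelFork.ofι (f := restrictHom k W hC)
      (extendHom (k := k) (hW.sdiff hC) Set.sdiff_subset 1) (extendHom_restrictHom hW hC)) :=
  have := mono_extendHom (k := k) (hW.sdiff hC) Set.sdiff_subset one_ne_zero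
  KernelFork.IsLimit.ofι' _ _ fun {F} g hg => ⟨liftExtendHom hC g hg, by
    apply Sheaf.hom_ext
    apply NatTrans.ext
    funext U
    apply ModuleCat.hom_ext
    apply LinearMap.ext
    intro t
    apply Subtype.ext
    funext x
    exact one_mul _⟩

/-- Surjectivity is only local: near a point where the section is nonzero it is constant on `W ∩ C`,
and this constant extends to a neighbourhood contained in the open set `W`. -/
lemma epi_restrictHom (hW : IsOpen W) {C : Set X} (hC : IsClosed C) :
    Epi (restrictHom k W hC) := by
  rw [← TopCat.Sheaf.isLocallySurjective_iff_epi, TopCat.Presheaf.isLocallySurjective_iff]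
  intro U s x hx
  change sectionsOn k (W ∩ C) U at s
  by_cases h : s.1 ⟨x, hx⟩ = 0
  · obtain ⟨V, hV, hxV, e⟩ := exists_secRes_eq_zero s hx h
    exact ⟨V, hV, ⟨0, (map_zero (secApp (restrictHom k W hC) V)).trans e.symm⟩, hxV⟩
  · have hxZ : x ∈ W ∩ C := by
      by_contra hZ
      exact h (s.2.1 ⟨x, hx⟩ hZ)
    obtain ⟨t, hts, ht, hxt⟩ := eventually_nhds_iff.1 (s.2.2.1 ⟨x, hx⟩ hxZ)
    -- Intersecting with `W` makes every constant function on `V` a section of `k_W`.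
    let V : Opens X := ⟨W ∩ (Subtype.val '' t),
      hW.inter (U.isOpen.isOpenEmbedding_subtypeVal.isOpenMap t ht)⟩
    have hV : V ≤ U := by
      rintro _ ⟨-, y, -, rfl⟩
      exact y.2
    let r : sectionsOn k W V := ⟨fun _ => s.1 ⟨x, hx⟩, fun y hy => absurd y.2.1 hy,
      fun _ _ => Filter.Eventually.of_forall fun _ _ => rfl, by simp [h]⟩
    refine ⟨V, hV, ⟨r, ?_⟩, hxZ.1, ⟨x, hx⟩, hxt, rfl⟩
    change secApp (restrictHom k W hC) V r = secRes hV s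
    apply Subtype.ext
    funext y
    obtain ⟨hyW, z, hz, hzy⟩ := y.2
    have hsy : (secRes hV s).1 y = s.1 z := congrArg s.1 (Subtype.ext hzy.symm)
    rw [hsy]
    by_cases hyC : y.1 ∈ C
    · rw [secApp_restrictHom _ _ _ hyC]
      exact (hts z hz (hzy ▸ ⟨hyW, hyC⟩)).symm
    · rw [secApp_restrictHom_of_notMem _ _ _ hyC]
      exact (s.2.1 _ fun h => hyC (hzy ▸ h.2)).symm

/-- The cokernel of `k_{W \ C} ⟶ k_W` is `k_{W ∩ C}`, for `W` open and `C` closed. -/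
def cokernelExtendHomIso (hW : IsOpen W) {C : Set X} (hC : IsClosed C) :
    cokernel (extendHom (k := k) (hW.sdiff hC) Set.sdiff_subset 1) ≅ sheafOn k X (W ∩ C) :=
  have := epi_restrictHom (k := k) hW hC
  (cokernelIsCokernel _).coconePointUniqueUpToIso
    (Abelian.epiIsCokernelOfKernel _ (isKernelExtendHom (k := k) hW hC))

end SheafOn

/-! ### Interval sheaves on the line -/

-- On the open set `O` of a decomposition `Z = O ∩ C`, the indicator function of the closed set `C`
-- is a section.
open Classical in
lemma hasUnitAt_of_isLocallyClosed (k : Type u) [Field k] {X : TopCat.{u}} {Z : Set X}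
    (h : IsLocallyClosed Z) {x : X} (hx : x ∈ Z) : HasUnitAt k Z x := by
  obtain ⟨O, C, hO, hC, rfl⟩ := h
  refine ⟨⟨O, hO⟩, hx.1, ⟨fun y => if y.1 ∈ C then 1 else 0, fun y hy => ?_, fun y hy => ?_, ?_⟩,
    if_pos hx.2⟩
  · exact if_neg fun h => hy ⟨y.2, h⟩
  · exact Filter.Eventually.of_forall fun z hz => (if_pos hz.2).trans (if_pos hy.2).symm
  · have : {y : (⟨O, hO⟩ : Opens X) | (if y.1 ∈ C then (1 : k) else 0) ≠ 0} = Subtype.val ⁻¹' C := by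
      ext y
      simp
    rw [this]
    exact hC.preimage continuous_subtype_val

lemma isLocallyClosed_of_ordConnected {I : Set ℝ} (h : I.OrdConnected) : IsLocallyClosed I := by
  have := h.isPreconnected.mem_intervals
  simp only [Set.mem_insert_iff, Set.mem_singleton_iff] at this
  rcases this with e | e | e | e | e | e | e | e | e | e <;> rw [e]
  · exact isClosed_Icc.isLocallyClosed
  · exact isLocallyClosed_Ico
  · exact isLocallyClosed_Ioc
  · exact isOpen_Ioo.isLocallyClosed
  · exact isClosed_Ici.isLocallyClosed
  · exact isOpen_Ioi.isLocallyClosed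
  · exact isClosed_Iic.isLocallyClosed
  · exact isOpen_Iio.isLocallyClosed
  · exact isOpen_univ.isLocallyClosed
  · exact isOpen_empty.isLocallyClosed

lemma hasUnitAt_of_ordConnected (k : Type u) [Field k] {I : Set ℝ} (h : I.OrdConnected)
    (x : Line.{u}) (hx : x ∈ (ULift.down ⁻¹' I : Set Line.{u})) :
    HasUnitAt k (X := Line.{u}) (ULift.down ⁻¹' I) x :=
  hasUnitAt_of_isLocallyClosed k
    ((isLocallyClosed_of_ordConnected h).preimage continuous_uliftDown) hx

lemma isPreconnected_preimage_down {I : Set ℝ} (h : I.OrdConnected) :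
    _root_.IsPreconnected (ULift.down ⁻¹' I : Set Line.{u}) :=
  (Homeomorph.ulift (X := ℝ)).isPreconnected_preimage.2 h.isPreconnected

lemma preimage_down_injective : Function.Injective fun I : Set ℝ =>
    (ULift.down ⁻¹' I : Set Line.{u}) :=
  ULift.down_surjective.preimage_injective

variable {k : Type u} [Field k]

/-- The scalar of an endomorphism of `k_I` is read at a point `x` of `I`. The test object is the
sheaf `k_{{x}}`, which receives nonzero morphisms only from intervals containing `x`; local
finiteness bounds their number. -/
lemma IsSheafBarcode.le {F : LineSheaf k} {B C : Set ℝ → ℕ} (hB : IsSheafBarcode F B)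
    (hC : IsSheafBarcode F C) : B ≤ C := by
  intro I
  by_cases h0 : B I = 0
  · rw [h0]
    exact Nat.zero_le _
  obtain ⟨⟨x, hx⟩, hI⟩ := hB.1 I h0
  obtain ⟨eB⟩ := hB.2.2
  obtain ⟨eC⟩ := hC.2.2
  obtain ⟨U, hU, hfin⟩ := hC.2.1 x
  have hone : coeffAt (X := Line.{u}) ⟨x⟩ (𝟙 (intervalSheaf k I)) = 1 :=
    coeffAt_id (hasUnitAt_of_ordConnected k hI _ hx)
  have hev : ∀ f : intervalSheaf k I ⟶ intervalSheaf k I,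
      f ≫ restrictHom k (ULift.down ⁻¹' I : Set Line.{u}) (isClosed_singleton (x := (⟨x⟩ : Line)))
        = 0 → coeffAt (X := Line.{u}) ⟨x⟩ f = 0 := by
    intro f hf
    rw [← coeffAt_comp_restrictHom (isClosed_singleton (x := (⟨x⟩ : Line)))
      (Set.mem_singleton _) f]
    exact (congrArg _ hf).trans (coeffAt_zero _)
  refine multiplicity_le (intervalSheaf k) (eB.symm ≪≫ eC) I
    (AddMonoidHom.mk' (coeffAt (X := Line.{u}) ⟨x⟩) (coeffAt_add _)) hone (coeffAt_comp _) ?_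
    (restrictHom k _ (isClosed_singleton (x := (⟨x⟩ : Line)))) hev ?_
  · intro J hJ0 hJ f g
    exact coeffAt_comp_eq_zero (hasUnitAt_of_ordConnected k hI)
      (hasUnitAt_of_ordConnected k (hC.1 J hJ0).2) (isPreconnected_preimage_down hI)
      (isPreconnected_preimage_down (hC.1 J hJ0).2)
      (fun e => hJ (preimage_down_injective e)) f g hx
  · refine hfin.subset ?_
    rintro J ⟨hJ0, f, hf⟩
    refine ⟨hJ0, x, ?_, mem_of_mem_nhds hU⟩
    by_contra hxJ
    refine hf (sheafOn_hom_ext_coeffAt fun y hy => ?_)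
    have hyx : y ∉ (ULift.down ⁻¹' I ∩ {(⟨x⟩ : Line)} : Set Line.{u}) := by
      rintro ⟨-, rfl⟩
      exact hxJ hy
    exact (coeffAt_eq_zero_of_notMem f hyx).trans (coeffAt_zero y).symm

/-- The barcode of a sheaf is unique. -/
lemma IsSheafBarcode.unique {F : LineSheaf k} {B C : Set ℝ → ℕ} (hB : IsSheafBarcode F B)
    (hC : IsSheafBarcode F C) : B = C :=
  le_antisymm (hB.le hC) (hC.le hB)

lemma isSheafBarcode_multiplicity {F : LineSheaf k} {ι : Type} [Fintype ι] (f : ι → Set ℝ)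
    (hf : ∀ t, (f t).Nonempty ∧ (f t).OrdConnected) (Y : ι → LineSheaf k)
    (hY : ∀ t, Nonempty (Y t ≅ intervalSheaf k (f t))) (e : F ≅ ⨁ Y) :
    IsSheafBarcode F (multiplicity f) := by
  refine ⟨fun I hI => ?_, fun x => ⟨Set.univ, Filter.univ_mem, ?_⟩, ?_⟩
  · obtain ⟨t, rfl⟩ := exists_of_multiplicity_ne_zero f hI
    exact hf t
  · refine (Set.finite_range f).subset ?_
    rintro I ⟨hI, -⟩
    exact exists_of_multiplicity_ne_zero f hI
  · obtain ⟨e₀⟩ := nonempty_biproduct_iso_sigma (intervalSheaf k) f Y hY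
    exact ⟨e ≪≫ e₀⟩

/-! ### The diagram of open half-lines -/

lemma isOpen_preimage_Ioi (b : ℝ) : IsOpen (ULift.down ⁻¹' Set.Ioi b : Set Line.{u}) :=
  (openRay b).isOpen

lemma preimage_Ioi_subset {b c : ℝ} (h : c ≤ b) :
    (ULift.down ⁻¹' Set.Ioi b : Set Line.{u}) ⊆ ULift.down ⁻¹' Set.Ioi c :=
  Set.preimage_mono (Set.Ioi_subset_Ioi h)

/-- The morphism `k_{(b, +∞)} ⟶ k_{(c, +∞)}` with a given scalar, which is zero unless `c ≤ b`. -/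
def rayHom (k : Type u) [Field k] (b c : ℝ) :
    k →+ (intervalSheaf k (Set.Ioi b) ⟶ intervalSheaf k (Set.Ioi c)) :=
  if h : c ≤ b then
    AddMonoidHom.mk' (fun s => extendHom (isOpen_preimage_Ioi b) (preimage_Ioi_subset h) s)
      (fun s t => sheafOn_hom_ext fun _ f => Subtype.ext (funext fun x => add_mul s t (f.1 x)))
  else 0

lemma rayHom_of_le {b c : ℝ} (h : c ≤ b) (s : k) :
    rayHom k b c s = extendHom (isOpen_preimage_Ioi b) (preimage_Ioi_subset h) s := by
  rw [rayHom, dif_pos h]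
  rfl

lemma coeffAt_eq_rayCoeff {b c : ℝ}
    (φ : intervalSheaf k (Set.Ioi b) ⟶ intervalSheaf k (Set.Ioi c)) {x : Line.{u}}
    (hx : x ∈ openRay.{u} b) : coeffAt x φ = rayCoeff φ := by
  rw [rayCoeff_eq φ ⟨x, hx⟩]
  exact coeffAt_eq φ hx (raySection k b) rfl

/-- The scalar at every point of `(b,+∞)` is `rayCoeff φ`, and these scalars determine `φ`. Thus the
complex of sheaves is recovered from its matrices of scalars. -/
lemma eq_rayHom {b c : ℝ} (φ : intervalSheaf k (Set.Ioi b) ⟶ intervalSheaf k (Set.Ioi c)) :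
    φ = rayHom k b c (rayCoeff φ) := by
  refine sheafOn_hom_ext_coeffAt fun x hx => ?_
  rw [coeffAt_eq_rayCoeff φ hx]
  rcases lt_or_ge b c with h | h
  · rw [rayCoeff_of_lt h, map_zero]
    exact (coeffAt_zero x).symm
  · rw [rayHom_of_le h, coeffAt_eq (x := x) _ (U := openRay b) hx (raySection k b) rfl]
    exact (mul_one _).symm

variable (k) in
/-- The diagram of the sheaves `k_{(b, +∞)}`. -/
def sheafRays : RayDiagram k ℝ (LineSheaf k) where
  obj b := intervalSheaf k (Set.Ioi b)
  map := rayHom k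
  map_one b := by
    rw [rayHom_of_le le_rfl]
    exact sheafOn_hom_ext fun _ f => Subtype.ext (funext fun x => one_mul (f.1 x))
  map_comp {b c e} h h' s t := by
    rw [rayHom_of_le h, rayHom_of_le h', rayHom_of_le (h'.trans h)]
    refine sheafOn_hom_ext fun _ f => Subtype.ext (funext fun x => ?_)
    change t * (s * f.1 x) = s * t * f.1 x
    ring
  mono_map h := by
    rw [rayHom_of_le h]
    exact mono_extendHom _ _ one_ne_zero

/-- The sets are variables related by equations, so that these can be substituted: the ray `(d,+∞)`
equals `(b,+∞) \ (-∞,d]` only up to a proof. -/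
lemma nonempty_cokernel_extendHom_iso {X : TopCat.{u}} {Z W C Y : Set X} (hZ : IsOpen Z)
    (h : Z ⊆ W) (hW : IsOpen W) (hC : IsClosed C) (eZ : Z = W \ C) (eY : Y = W ∩ C) :
    Nonempty (cokernel (extendHom (k := k) hZ h 1) ≅ sheafOn k X Y) := by
  subst eZ eY
  exact ⟨cokernelExtendHomIso hW hC⟩

/-- Removing the open ray `(d,+∞)` from `(b,+∞)` leaves the intersection with the closed ray
`(-∞,d]`, so the death belongs to the bar and the birth does not. -/
lemma nonempty_sheafRays_bar_iso {b d : ℝ} (h : b ≤ d) :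
    Nonempty ((sheafRays k).bar b d ≅ intervalSheaf k (Set.Ioc b d)) := by
  change Nonempty (cokernel (rayHom k d b 1) ≅ intervalSheaf k (Set.Ioc b d))
  rw [rayHom_of_le h]
  refine nonempty_cokernel_extendHom_iso (C := ULift.down ⁻¹' Set.Iic d) _ _
    (isOpen_preimage_Ioi b) (isClosed_Iic.preimage continuous_uliftDown) ?_ rfl
  ext x
  simp only [Set.mem_preimage, Set.mem_Ioi, Set.mem_sdiff, Set.mem_Iic, not_le]
  exact ⟨fun h' => ⟨h.trans_lt h', h'⟩, fun h' => h'.2⟩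

/-! ### Morphisms between indicator modules -/

section Indicator

variable {k : Type u} [Field k] {P : Type} [LinearOrder P] {A B : Set P} [A.OrdConnected]
  [B.OrdConnected]

/-- The action at `x` of a morphism of indicator modules. -/
def indApp (φ : indicatorModule k A ⟶ indicatorModule k B) (x : P) :
    indicatorSpace k A x →ₗ[k] indicatorSpace k B x :=
  (φ.app x).hom

open Classical in
/-- The scalar by which a morphism of indicator modules acts at `x`. -/
def indCoeff (x : P) (φ : indicatorModule k A ⟶ indicatorModule k B) : k :=
  if h : x ∈ A then (indApp φ x ⟨1, fun h' => absurd h h'⟩).1 else 0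

lemma indCoeff_of_mem {x : P} (h : x ∈ A) (φ : indicatorModule k A ⟶ indicatorModule k B) :
    indCoeff x φ = (indApp φ x ⟨1, fun h' => absurd h h'⟩).1 :=
  dif_pos h

lemma indApp_apply (φ : indicatorModule k A ⟶ indicatorModule k B) (x : P)
    (v : indicatorSpace k A x) : (indApp φ x v).1 = indCoeff x φ * v.1 := by
  by_cases h : x ∈ A
  · have : v = v.1 • (⟨1, fun h' => absurd h h'⟩ : indicatorSpace k A x) :=
      Subtype.ext (mul_one v.1).symm
    rw [indCoeff_of_mem h, mul_comm]
    exact (congrArg (fun w => (indApp φ x w).1) this).trans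
      (congrArg Subtype.val ((indApp φ x).map_smul v.1 _))
  · have : v = 0 := Subtype.ext (v.2 h)
    rw [this, map_zero]
    exact (mul_zero _).symm

lemma indCoeff_add (x : P) (φ ψ : indicatorModule k A ⟶ indicatorModule k B) :
    indCoeff x (φ + ψ) = indCoeff x φ + indCoeff x ψ := by
  by_cases h : x ∈ A
  · rw [indCoeff_of_mem h, indCoeff_of_mem h, indCoeff_of_mem h]
    rfl
  · simp [indCoeff, h]

lemma indCoeff_id {x : P} (h : x ∈ A) : indCoeff x (𝟙 (indicatorModule k A)) = 1 :=
  indCoeff_of_mem h _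

lemma indCoeff_comp {C : Set P} [C.OrdConnected] (x : P)
    (φ : indicatorModule k A ⟶ indicatorModule k B)
    (ψ : indicatorModule k B ⟶ indicatorModule k C) :
    indCoeff x (φ ≫ ψ) = indCoeff x φ * indCoeff x ψ := by
  by_cases h : x ∈ A
  · rw [indCoeff_of_mem h (φ ≫ ψ)]
    change (indApp ψ x (indApp φ x _)).1 = _
    rw [indApp_apply, indApp_apply]
    ring
  · simp [indCoeff, h]

lemma indCoeff_eq_zero_of_notMem {x : P} (φ : indicatorModule k A ⟶ indicatorModule k B)
    (h : x ∉ B) : indCoeff x φ = 0 := by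
  by_cases h' : x ∈ A
  · rw [indCoeff_of_mem h']
    exact (indApp φ x _).2 h
  · simp [indCoeff, h']

/-- This is naturality along `x ≤ y`, as both structure maps are identities there. -/
lemma indCoeff_eq_of_le {x y : P} (hxy : x ≤ y) (hx : x ∈ A ∩ B) (hy : y ∈ A ∩ B)
    (φ : indicatorModule k A ⟶ indicatorModule k B) : indCoeff x φ = indCoeff y φ := by
  classical
  have nat : indApp φ y (indicatorStep k A x y ⟨1, fun h' => absurd hx.1 h'⟩) =
      indicatorStep k B x y (indApp φ x ⟨1, fun h' => absurd hx.1 h'⟩) :=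
    congrArg (fun g => g.hom (⟨1, fun h' => absurd hx.1 h'⟩ : indicatorSpace k A x))
      (φ.naturality (homOfLE hxy))
  have := congrArg Subtype.val nat
  rw [indApp_apply] at this
  change _ * (if y ∈ A then (1 : k) else 0) = if y ∈ B then (indApp φ x _).1 else 0 at this
  rw [if_pos hy.1, if_pos hy.2, indApp_apply] at this
  simpa using this.symm

lemma indCoeff_eq {x y : P} (hx : x ∈ A ∩ B) (hy : y ∈ A ∩ B)
    (φ : indicatorModule k A ⟶ indicatorModule k B) : indCoeff x φ = indCoeff y φ := by
  rcases le_total x y with h | h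
  · exact indCoeff_eq_of_le h hx hy φ
  · exact (indCoeff_eq_of_le h hy hx φ).symm

/-- A composite `k^A ⟶ k^B ⟶ k^A` with `B ≠ A` vanishes. -/
lemma indCoeff_comp_eq_zero (hne : B ≠ A) (φ : indicatorModule k A ⟶ indicatorModule k B)
    (ψ : indicatorModule k B ⟶ indicatorModule k A) {x : P} (hx : x ∈ A) :
    indCoeff x (φ ≫ ψ) = 0 := by
  by_cases hxB : x ∈ B
  · by_cases h : A ⊆ B
    · obtain ⟨y, hyB, hyA⟩ : ∃ y ∈ B, y ∉ A := by
        by_contra! h'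
        exact hne (Set.Subset.antisymm h' h)
      rw [indCoeff_comp, mul_comm, ← indCoeff_comp, indCoeff_eq ⟨hxB, hxB⟩ ⟨hyB, hyB⟩ (ψ ≫ φ),
        indCoeff_comp, indCoeff_eq_zero_of_notMem ψ hyA, zero_mul]
    · obtain ⟨y, hyA, hyB⟩ := Set.not_subset.1 h
      rw [indCoeff_eq ⟨hx, hx⟩ ⟨hyA, hyA⟩ (φ ≫ ψ), indCoeff_comp,
        indCoeff_eq_zero_of_notMem φ hyB, zero_mul]
  · rw [indCoeff_comp, indCoeff_eq_zero_of_notMem φ hxB, zero_mul]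

end Indicator

/-! ### Barcodes over a finite linear order -/

section ModuleBarcode

variable {k : Type u} [Field k] {m : ℕ} {M : Fin (m + 1) ⥤ ModuleCat.{u} k}

lemma IsModuleBarcode.le {B C : NonemptyInterval (Fin (m + 1)) → ℕ} (hB : IsModuleBarcode M B)
    (hC : IsModuleBarcode M C) : B ≤ C := by
  intro I
  obtain ⟨eB⟩ := hB
  obtain ⟨eC⟩ := hC
  have hI : I.fst ∈ Set.Icc I.fst I.snd := ⟨le_rfl, I.fst_le_snd⟩
  refine multiplicity_le (fun I : NonemptyInterval (Fin (m + 1)) =>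
      indicatorModule k (Set.Icc I.fst I.snd)) (eB.symm ≪≫ eC) I
    (AddMonoidHom.mk' (indCoeff I.fst) (indCoeff_add _)) (indCoeff_id hI) (indCoeff_comp _) ?_
    -- There are finitely many intervals, so the identity serves as the test morphism.
    (𝟙 _) ?_ (Set.toFinite _)
  · intro J _ hJ f g
    refine indCoeff_comp_eq_zero (fun e => hJ ?_) f g hI
    obtain ⟨h1, h2⟩ := (Set.Icc_eq_Icc_iff J.fst_le_snd).1 e
    exact NonemptyInterval.ext (Prod.ext h1 h2)
  · intro f hf
    rw [Category.comp_id] at hf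
    rw [hf, map_zero]

/-- The barcode of a persistence module is unique. -/
lemma IsModuleBarcode.unique {B C : NonemptyInterval (Fin (m + 1)) → ℕ} (hB : IsModuleBarcode M B)
    (hC : IsModuleBarcode M C) : B = C :=
  le_antisymm (hB.le hC) (hC.le hB)

lemma isModuleBarcode_multiplicity {ι : Type} [Fintype ι]
    (f : ι → NonemptyInterval (Fin (m + 1))) (Y : ι → Fin (m + 1) ⥤ ModuleCat.{u} k)
    (hY : ∀ t, Nonempty (Y t ≅ indicatorModule k (Set.Icc (f t).fst (f t).snd))) (e : M ≅ ⨁ Y) :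
    IsModuleBarcode M (multiplicity f) := by
  obtain ⟨e₀⟩ := nonempty_biproduct_iso_sigma
    (fun I : NonemptyInterval (Fin (m + 1)) => indicatorModule k (Set.Icc I.fst I.snd)) f Y hY
  exact ⟨e ≪≫ e₀⟩

end ModuleBarcode

/-! ### The diagram of free persistence modules -/

section UpModule

variable (k : Type u) [Field k] {P : Type} [LinearOrder P] {i : P → ℝ} (hi : Monotone i)

/-- The pullback of persistence modules along a monotone map. -/
abbrev pullback : (ℝ ⥤ ModuleCat.{u} k) ⥤ (P ⥤ ModuleCat.{u} k) :=
  (Functor.whiskeringLeft _ _ (ModuleCat.{u} k)).obj hi.functor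

/-- The diagram of the pullbacks of the modules `k^{[b, +∞)}`. -/
def moduleRays : RayDiagram k ℝ (P ⥤ ModuleCat.{u} k) where
  obj b := (pullback k hi).obj (upModule k b)
  map b c := AddMonoidHom.mk' (fun s => (pullback k hi).map (s • upMap k b c)) (fun s t => by
    rw [add_smul, Functor.map_add])
  map_one b := by
    have : upMap k b b = 𝟙 _ := by
      apply NatTrans.ext
      funext x
      apply ModuleCat.hom_ext
      apply LinearMap.ext
      intro v
      exact Subtype.ext (if_pos le_rfl)
    simp only [AddMonoidHom.mk'_apply, one_smul, this]
    exact (pullback k hi).map_id _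
  map_comp h h' s t := by
    simp only [AddMonoidHom.mk'_apply]
    rw [← Functor.map_comp, Linear.smul_comp, Linear.comp_smul, upMap_comp k h h', smul_smul]
  mono_map {b c} h := by
    simp only [AddMonoidHom.mk'_apply, one_smul]
    have : ∀ x, Mono (((pullback k hi).map (upMap k b c)).app x) := by
      intro x
      rw [ModuleCat.mono_iff_injective]
      intro v w e
      have e' : (if c ≤ b then v.1 else 0) = if c ≤ b then w.1 else 0 := congrArg Subtype.val e
      rw [if_pos h, if_pos h] at e'
      exact Subtype.ext e'
    exact NatTrans.mono_of_mono_app _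

variable {k hi} {b : ℝ} {A : Set P} [A.OrdConnected]

open Classical in
/-- The truncation of the pullback of `k^{[b, +∞)}` to a lower part of the preimage of
`[b, +∞)`. -/
def upQuotient (k : Type u) [Field k] (hi : Monotone i)
    (h : ∀ x y, x ≤ y → b ≤ i x → y ∈ A → x ∈ A) :
    (pullback k hi).obj (upModule k b) ⟶ indicatorModule k A where
  app x := ModuleCat.ofHom
    { toFun v := (⟨if x ∈ A then v.1 else 0, fun hx => if_neg hx⟩ : indicatorSpace k A x)
      map_add' v w := by
        apply Subtype.ext
        change (if x ∈ A then v.1 + w.1 else 0)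
          = (if x ∈ A then v.1 else 0) + if x ∈ A then w.1 else 0
        split_ifs <;> simp
      map_smul' c v := by
        apply Subtype.ext
        change (if x ∈ A then c * v.1 else 0) = c * if x ∈ A then v.1 else 0
        split_ifs <;> simp }
  naturality x y f := by
    apply ModuleCat.hom_ext
    apply LinearMap.ext
    intro v
    apply Subtype.ext
    have hv : ¬ b ≤ i x → v.1 = 0 := v.2
    change (if y ∈ A then (if b ≤ i y then v.1 else 0) else 0)
      = if y ∈ A then (if x ∈ A then v.1 else 0) else 0
    have hxy : x ≤ y := leOfHom f
    by_cases hy : y ∈ A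
    · by_cases hb : b ≤ i x
      · simp [hy, hb.trans (hi hxy), h x y hxy hb hy]
      · simp [hv hb]
    · simp [hy]

lemma epi_upQuotient (h : ∀ x y, x ≤ y → b ≤ i x → y ∈ A → x ∈ A) (hA : ∀ x ∈ A, b ≤ i x) :
    Epi (upQuotient k hi h) := by
  have : ∀ x, Epi ((upQuotient k hi h).app x) := by
    intro x
    rw [ModuleCat.epi_iff_surjective]
    intro (v : indicatorSpace k A x)
    refine ⟨(⟨v.1, fun hx => v.2 fun hxA => hx (hA x hxA)⟩ : indicatorSpace k (Set.Ici b) (i x)),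
      Subtype.ext ?_⟩
    by_cases hx : x ∈ A
    · exact if_pos hx
    · exact (if_neg hx).trans (v.2 hx).symm
  exact NatTrans.epi_of_epi_app _

lemma mono_upQuotient (h : ∀ x y, x ≤ y → b ≤ i x → y ∈ A → x ∈ A) (hA : ∀ x, b ≤ i x → x ∈ A) :
    Mono (upQuotient k hi h) := by
  classical
  have : ∀ x, Mono ((upQuotient k hi h).app x) := by
    intro x
    rw [ModuleCat.mono_iff_injective]
    intro (v : indicatorSpace k (Set.Ici b) (i x)) (w : indicatorSpace k (Set.Ici b) (i x)) e
    have e' : (if x ∈ A then v.1 else 0) = if x ∈ A then w.1 else 0 := congrArg Subtype.val e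
    apply Subtype.ext
    by_cases hx : x ∈ A
    · rwa [if_pos hx, if_pos hx] at e'
    · rw [v.2 fun hb => hx (hA x hb), w.2 fun hb => hx (hA x hb)]
  exact NatTrans.mono_of_mono_app _

lemma nonempty_moduleRays_bar_top_iso (hA : ∀ x, x ∈ A ↔ b ≤ i x) :
    Nonempty ((moduleRays k hi).bar b ⊤ ≅ indicatorModule k A) := by
  have h : ∀ x y, x ≤ y → b ≤ i x → y ∈ A → x ∈ A := fun x _ _ hx _ => (hA x).2 hx
  have := epi_upQuotient (k := k) (hi := hi) h fun x => (hA x).1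
  have := mono_upQuotient (k := k) (hi := hi) h fun x => (hA x).2
  have := isIso_of_mono_of_epi (upQuotient k hi h)
  let e := asIso (upQuotient k hi h)
  exact ⟨e⟩

/-- The kernel of the truncation of `k^{[b, +∞)}` is `k^{[d, +∞)}`. -/
def isKernelUpQuotient {d : ℝ} (hbd : b ≤ d) (h : ∀ x y, x ≤ y → b ≤ i x → y ∈ A → x ∈ A)
    (hA : ∀ x, x ∈ A ↔ b ≤ i x ∧ i x < d) :
    IsLimit (KernelFork.ofι (f := upQuotient k hi h)
      ((pullback k hi).map ((1 : k) • upMap k d b)) (by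
      classical
      apply NatTrans.ext
      funext x
      apply ModuleCat.hom_ext
      apply LinearMap.ext
      intro (v : indicatorSpace k (Set.Ici d) (i x))
      apply Subtype.ext
      change (if x ∈ A then 1 * (if b ≤ d then v.1 else 0) else 0) = 0
      by_cases hx : x ∈ A
      · rw [v.2 fun hd => (not_lt.2 hd) ((hA x).1 hx).2]
        simp
      · exact if_neg hx)) :=
  have : Mono ((pullback k hi).map ((1 : k) • upMap k d b)) := (moduleRays k hi).mono_map hbd
  KernelFork.IsLimit.ofι' _ _ fun {N} g hg => by
    classical
    let ev (x : P) : N.obj x →ₗ[k] indicatorSpace k (Set.Ici b) (i x) := (g.app x).hom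
    -- An element killed by the truncation can be nonzero only at points `x` with `b ≤ i x` and `x ∉
    -- A`, that is, with `d ≤ i x`.
    have key : ∀ x v, (ev x v).1 ∈ indicatorSpace k (Set.Ici d) (i x) := by
      intro x v hx
      by_cases hxA : x ∈ A
      · have : (if x ∈ A then (ev x v).1 else 0) = 0 :=
          congrArg (fun φ : N ⟶ indicatorModule k A =>
            (show indicatorSpace k A x from (φ.app x).hom v).1) hg
        rwa [if_pos hxA] at this
      · exact (ev x v).2 fun hb => hxA ((hA x).2 ⟨hb, not_le.1 hx⟩)
    let l (x : P) : N.obj x →ₗ[k] indicatorSpace k (Set.Ici d) (i x) :=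
      ((indicatorSpace k (Set.Ici b) (i x)).subtype ∘ₗ ev x).codRestrict _ (key x)
    have hl : ∀ x v, upStep k d b (i x) (l x v) = ev x v := fun x v =>
      Subtype.ext (if_pos hbd)
    refine ⟨⟨fun x => ModuleCat.ofHom (l x), fun x y f => ?_⟩, ?_⟩
    · apply ModuleCat.hom_ext
      apply LinearMap.ext
      intro v
      apply Subtype.ext
      have e : (ev y ((N.map f).hom v)).1 = if b ≤ i y then (ev x v).1 else 0 :=
        congrArg (fun φ => (show indicatorSpace k (Set.Ici b) (i y) from φ.hom v).1)
          (g.naturality f)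
      change (ev y ((N.map f).hom v)).1 = if d ≤ i y then (ev x v).1 else 0
      rw [e]
      by_cases hd : d ≤ i y
      · rw [if_pos hd, if_pos (hbd.trans hd)]
      · have : (ev x v).1 = 0 := key x v fun hx => hd (le_trans hx (hi (leOfHom f)))
        rw [this]
        simp
    · apply NatTrans.ext
      funext x
      apply ModuleCat.hom_ext
      apply LinearMap.ext
      intro v
      exact (one_smul k _).trans (hl x v)

/-- The truncation of `k^{[b,+∞)}` to `b ≤ i x < d` is an epimorphism with kernel `k^{[d,+∞)}`, so
it is the cokernel. Here, unlike for sheaves, the birth belongs to the bar and the death does not.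
-/
lemma nonempty_moduleRays_bar_iso {d : ℝ} (hbd : b ≤ d) (hA : ∀ x, x ∈ A ↔ b ≤ i x ∧ i x < d) :
    Nonempty ((moduleRays k hi).bar b d ≅ indicatorModule k A) := by
  have h : ∀ x y, x ≤ y → b ≤ i x → y ∈ A → x ∈ A := fun x y hxy hx hy =>
    (hA x).2 ⟨hx, (hi hxy).trans_lt ((hA y).1 hy).2⟩
  have := epi_upQuotient (k := k) (hi := hi) h fun x hx => ((hA x).1 hx).1
  change Nonempty (cokernel ((pullback k hi).map ((1 : k) • upMap k d b)) ≅ indicatorModule k A)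
  exact ⟨(cokernelIsCokernel _).coconePointUniqueUpToIso
    (Abelian.epiIsCokernelOfKernel _ (isKernelUpQuotient (k := k) (hi := hi) hbd h hA))⟩

end UpModule

/-! ### The matrix complex of a finite open complex -/

lemma RayDiagram.ι_real_π {k Γ : Type*} [Field k] [LinearOrder Γ] {𝒜 : Type*} [Category 𝒜]
    [Preadditive 𝒜] [HasFiniteBiproducts 𝒜] (X : RayDiagram k Γ 𝒜) {I J : Type} [Fintype I]
    [Fintype J] (a : I → Γ) (b : J → Γ) (M : Matrix I J k) (i : I) (j : J) :
    biproduct.ι (fun i => X.obj (a i)) i ≫ X.real a b M ≫ biproduct.π (fun j => X.obj (b j)) j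
      = X.map (a i) (b j) (M i j) := by
  rw [RayDiagram.real, biproduct.matrix_π, biproduct.ι_desc]

/-- The homology of a complex whose terms and differentials are given by matrices. -/
def homologyIsoOfMatrices {k Γ : Type*} [Field k] [LinearOrder Γ] {𝒜 : Type*} [Category 𝒜]
    [Abelian 𝒜] (X : RayDiagram k Γ 𝒜) (K : MatrixComplex k Γ) (C : CochainComplex 𝒜 ℤ) (n : ℤ)
    (e₁ : C.X (n - 1) ≅ ⨁ fun j => X.obj (K.a₁ j)) (e₂ : C.X n ≅ ⨁ fun j => X.obj (K.a₂ j))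
    (e₃ : C.X (n + 1) ≅ ⨁ fun j => X.obj (K.a₃ j))
    (h₁ : C.d (n - 1) n ≫ e₂.hom = e₁.hom ≫ X.real K.a₁ K.a₂ K.D₁)
    (h₂ : C.d n (n + 1) ≫ e₃.hom = e₂.hom ≫ X.real K.a₂ K.a₃ K.D₂) :
    C.homology n ≅ (X.complex K).homology :=
  ShortComplex.homologyMapIso
    (C.isoSc' (n - 1) n (n + 1) (CochainComplex.prev ℤ n) (CochainComplex.next ℤ n) ≪≫
      ShortComplex.isoMk (S₁ := C.sc' (n - 1) n (n + 1)) (S₂ := X.complex K) e₁ e₂ e₃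
        h₁.symm h₂.symm)

namespace FiniteOpenComplex

variable {k : Type u} [Field k] (ℒ : FiniteOpenComplex k)

/-- The matrix of the differential. -/
def matrix (n p : ℤ) : Matrix (ℒ.J n) (ℒ.J p) k := fun j j' => rayCoeff (ℒ.component n p j j')

open Classical in
/-- The part of degrees `n - 1`, `n`, `n + 1` of the matrices of the differentials. -/
def matrixComplex (n : ℤ) : MatrixComplex k ℝ where
  J₁ := ℒ.J (n - 1)
  J₂ := ℒ.J n
  J₃ := ℒ.J (n + 1)
  a₁ j := j
  a₂ j := j
  a₃ j := j
  D₁ := ℒ.matrix (n - 1) n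
  D₂ := ℒ.matrix n (n + 1)
  adm₁ _ _ h := not_lt.1 fun h' => h (rayCoeff_of_lt h' _)
  adm₂ _ _ h := not_lt.1 fun h' => h (rayCoeff_of_lt h' _)
  mul_eq_zero := by
    ext j j''
    have e := congrArg rayCoeff (sum_component_comp ℒ (n - 1) n (n + 1) j j'')
    rw [rayCoeff_sum, rayCoeff_zero] at e
    simp only [rayCoeff_comp] at e
    exact e

lemma diff_eq_real (n p : ℤ) : ℒ.diff n p =
    (sheafRays k).real (fun j : ℒ.J n => (j : ℝ)) (fun j : ℒ.J p => (j : ℝ)) (ℒ.matrix n p) := by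
  refine biproduct.hom_ext _ _ fun j' => biproduct.hom_ext' _ _ fun j => ?_
  exact (eq_rayHom (ℒ.component n p j j')).trans
    ((sheafRays k).ι_real_π _ _ (ℒ.matrix n p) j j').symm

/-- The cohomology of the complex of sheaves, in terms of matrices. -/
def cpxHomologyIso (n : ℤ) :
    ℒ.cpx.homology n ≅ ((sheafRays k).complex (ℒ.matrixComplex n)).homology :=
  homologyIsoOfMatrices (sheafRays k) (ℒ.matrixComplex n) ℒ.cpx n (ℒ.iso _) (ℒ.iso _) (ℒ.iso _)
    (((ℒ.iso (n - 1)).inv_comp_eq).1 (ℒ.diff_eq_real (n - 1) n))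
    (((ℒ.iso n).inv_comp_eq).1 (ℒ.diff_eq_real n (n + 1)))

/-- The terms of the restricted complex. -/
def restrictedIso (n : ℤ) :
    ℒ.restricted.X n ≅ ⨁ fun j : ℒ.J n => (moduleRays k ℒ.i_monotone).obj (j : ℝ) :=
  (pullback k ℒ.i_monotone).mapBiproduct fun j : ℒ.J n => upModule k (j : ℝ)

/-- Restriction along `i` is additive, so it preserves direct sums and the components of morphisms;
the components of the differential of `L` have the scalars of `ℒ` by construction. -/
lemma restricted_d_comp (n p : ℤ) : ℒ.restricted.d n p ≫ (ℒ.restrictedIso p).hom =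
    (ℒ.restrictedIso n).hom ≫ (moduleRays k ℒ.i_monotone).real (fun j : ℒ.J n => (j : ℝ))
      (fun j : ℒ.J p => (j : ℝ)) (ℒ.matrix n p) := by
  rw [← Iso.inv_comp_eq]
  refine biproduct.hom_ext _ _ fun j' => biproduct.hom_ext' _ _ fun j => ?_
  refine Eq.trans ?_ ((moduleRays k ℒ.i_monotone).ι_real_π _ _ (ℒ.matrix n p) j j').symm
  let f := fun j : ℒ.J n => upModule k (j : ℝ)
  let g := fun j : ℒ.J p => upModule k (j : ℝ)
  let F := pullback k ℒ.i_monotone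
  have e₁ : biproduct.ι (fun j => F.obj (f j)) j ≫ (ℒ.restrictedIso n).inv
      = F.map (biproduct.ι f j) := by
    change _ ≫ (F.mapBiproduct f).inv = _
    rw [Functor.mapBiproduct_inv, biproduct.ι_desc]
  have e₂ : (ℒ.restrictedIso p).hom ≫ biproduct.π (fun j => F.obj (g j)) j'
      = F.map (biproduct.π g j') := by
    change (F.mapBiproduct g).hom ≫ _ = _
    rw [Functor.mapBiproduct_hom, biproduct.lift_π]
  let d : (⨁ f) ⟶ ⨁ g := ℒ.free.d n p
  have e₃ : biproduct.ι f j ≫ d ≫ biproduct.π g j'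
      = ℒ.matrix n p j j' • upMap k (j : ℝ) (j' : ℝ) := by
    change biproduct.ι f j ≫ biproduct.matrix _ ≫ biproduct.π g j' = _
    rw [biproduct.matrix_π, biproduct.ι_desc]
    rfl
  have e₄ := congrArg F.map e₃
  rw [F.map_comp, F.map_comp, ← e₁, ← e₂] at e₄
  simp only [Category.assoc] at e₄ ⊢
  exact e₄

/-- The cohomology of the restricted complex, in terms of matrices. -/
def restrictedHomologyIso (n : ℤ) : ℒ.restricted.homology n ≅
    ((moduleRays k ℒ.i_monotone).complex (ℒ.matrixComplex n)).homology :=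
  homologyIsoOfMatrices (moduleRays k ℒ.i_monotone) (ℒ.matrixComplex n) ℒ.restricted n
    (ℒ.restrictedIso _) (ℒ.restrictedIso _) (ℒ.restrictedIso _) (ℒ.restricted_d_comp _ _)
    (ℒ.restricted_d_comp _ _)

/-! ### Intervals attached to bars -/

lemma i_succ (r : Fin ℒ.m) : ℒ.i r.succ = ℒ.enum r := rfl

/-- The shift by `1` puts `i 0` strictly below all generators, and the remaining values enumerate
distinct generators. Inequalities between values of `i` thus become inequalities in `[m]`. -/
lemma i_strictMono : StrictMono ℒ.i := by
  refine ℒ.i_monotone.strictMono_of_injective fun a b h => ?_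
  have key : ∀ r : Fin ℒ.m, ℒ.i 0 < ℒ.i r.succ := by
    intro r
    have hm : 0 < ℒ.m := r.pos
    have : ℒ.enum ⟨0, hm⟩ ≤ ℒ.enum r := ℒ.enum.monotone (Nat.zero_le _)
    simp only [i, Fin.cases_zero, Fin.cases_succ, hm, dif_pos]
    linarith
  induction a using Fin.cases with
  | zero =>
    induction b using Fin.cases with
    | zero => rfl
    | succ b => exact absurd h (key b).ne
  | succ a =>
    induction b using Fin.cases with
    | zero => exact absurd h (key a).ne'
    | succ b => exact congrArg Fin.succ (ℒ.enum.injective h)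

lemma exists_enum_eq {n : ℤ} (j : ℒ.J n) : ∃ r, ℒ.enum r = (j : ℝ) := by
  have hj : (j : ℝ) ∈ ℒ.J n := Multiset.coe_mem
  have : (j : ℝ) ∈ ℒ.generators := by
    refine Finset.mem_biUnion.2 ⟨n, Finsupp.mem_support_iff.2 ?_, Multiset.mem_toFinset.2 hj⟩
    exact fun h => Multiset.notMem_zero _ (h ▸ hj : (j : ℝ) ∈ (0 : Multiset ℝ))
  have hr : (j : ℝ) ∈ Set.range ℒ.enum := by
    have e := Finset.range_orderEmbOfFin ℒ.generators (k := ℒ.m) rfl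
    exact e.symm ▸ this
  exact hr

end FiniteOpenComplex

lemma alphaInv_Ici (b : ℝ) : alphaInv (Set.Ici b) = Set.Ioi b := by
  have h₁ : (upperClosure (Set.Ici b) : Set ℝ) = Set.Ici b := (isUpperSet_Ici b).upperClosure
  have h₂ : (lowerClosure (Set.Ici b) : Set ℝ) = Set.univ := by
    refine Set.eq_univ_of_forall fun x => mem_lowerClosure.2 ⟨max x b, ?_, le_max_left _ _⟩
    exact le_max_right x b
  rw [alphaInv, h₁, h₂, interior_Ici, closure_univ, Set.inter_univ]

lemma alphaInv_Ico {b d : ℝ} (h : b < d) : alphaInv (Set.Ico b d) = Set.Ioc b d := by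
  have h₁ : (upperClosure (Set.Ico b d) : Set ℝ) = Set.Ici b := by
    ext x
    refine mem_upperClosure.trans ⟨?_, fun hx => ⟨b, ⟨le_rfl, h⟩, hx⟩⟩
    rintro ⟨y, hy, hyx⟩
    exact hy.1.trans hyx
  have h₂ : (lowerClosure (Set.Ico b d) : Set ℝ) = Set.Iio d := by
    ext x
    refine mem_lowerClosure.trans ⟨?_, fun hx => ⟨max x b, ⟨le_max_right _ _, max_lt hx h⟩,
      le_max_left _ _⟩⟩
    rintro ⟨y, hy, hyx⟩
    exact hyx.trans_lt hy.2
  rw [alphaInv, h₁, h₂, interior_Ici, closure_Iio]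
  rfl

/-! ### The two realizations of a bar -/

namespace FiniteOpenComplex

variable {k : Type u} [Field k] (ℒ : FiniteOpenComplex k)

/-- The indicator module of `I` and the sheaf of the corresponding interval of the line are the
two realizations of the bar with birth `b` and death `d`. -/
structure Represents (b : ℝ) (d : WithTop ℝ) (I : NonemptyInterval (Fin (ℒ.m + 1))) : Prop where
  module : Nonempty ((moduleRays k ℒ.i_monotone).bar b d ≅ indicatorModule k (Set.Icc I.fst I.snd))
  sheaf : Nonempty ((sheafRays k).bar b d ≅ intervalSheaf k (alphaInv (ℒ.iShriek I)))
  nonempty : (alphaInv (ℒ.iShriek I)).Nonempty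
  ordConnected : (alphaInv (ℒ.iShriek I)).OrdConnected

lemma represents_top (r : Fin ℒ.m) :
    ℒ.Represents (ℒ.enum r) ⊤ ⟨(r.succ, Fin.last _), Fin.le_last _⟩ := by
  have h : alphaInv (ℒ.iShriek ⟨(r.succ, Fin.last _), Fin.le_last _⟩) = Set.Ioi (ℒ.enum r) := by
    rw [iShriek, if_pos rfl]
    exact alphaInv_Ici _
  refine ⟨nonempty_moduleRays_bar_top_iso fun x => ?_, ?_, ?_, ?_⟩
  · rw [← ℒ.i_succ, ℒ.i_strictMono.le_iff_le]
    exact and_iff_left (Fin.le_last x)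
  · rw [h]
    exact ⟨Iso.refl _⟩
  · rw [h]
    exact Set.nonempty_Ioi
  · rw [h]
    exact Set.ordConnected_Ioi

lemma represents_coe {r s : Fin ℒ.m} (hrs : ℒ.enum r < ℒ.enum s) :
    ℒ.Represents (ℒ.enum r) (ℒ.enum s)
      ⟨(r.succ, s.castSucc), Fin.succ_le_castSucc_iff.2 (ℒ.enum.lt_iff_lt.1 hrs)⟩ := by
  have h : alphaInv (ℒ.iShriek ⟨(r.succ, s.castSucc),
      Fin.succ_le_castSucc_iff.2 (ℒ.enum.lt_iff_lt.1 hrs)⟩) = Set.Ioc (ℒ.enum r) (ℒ.enum s) := by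
    rw [iShriek, if_neg (Fin.castSucc_ne_last s)]
    change alphaInv (Set.Ico (ℒ.i r.succ) (ℒ.i (s.castSucc + 1))) = _
    -- `enum` counts from `0` and `i` from `1`, so the last point before the death `enum s = i
    -- s.succ` is `s.castSucc`. Adding `1` to it does not wrap around.
    rw [Fin.coeSucc_eq_succ, i_succ, i_succ, alphaInv_Ico hrs]
  refine ⟨nonempty_moduleRays_bar_iso hrs.le fun x => ?_, ?_, ?_, ?_⟩
  · change r.succ ≤ x ∧ x ≤ s.castSucc ↔ ℒ.i r.succ ≤ ℒ.i x ∧ ℒ.i x < ℒ.i s.succ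
    rw [ℒ.i_strictMono.le_iff_le, ℒ.i_strictMono.lt_iff_lt, Fin.le_castSucc_iff]
  · rw [h]
    exact nonempty_sheafRays_bar_iso hrs.le
  · rw [h]
    exact Set.nonempty_Ioc.2 hrs
  · rw [h]
    exact Set.ordConnected_Ioc

/-- Births are generators in degree `n` and finite deaths are generators in degree `n - 1`, so both
are values of `enum`. The strict inequality makes the interval of `[m]` nonempty. -/
lemma exists_represents {n : ℤ} (B : MatrixComplex.Bars (ℒ.matrixComplex n)) (t : B.ι) :
    ∃ I, ℒ.Represents (B.birth t) (B.death t) I := by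
  have hlt := B.lt t
  obtain ⟨j, hj⟩ := B.mem_birth t
  obtain ⟨r, hr⟩ := ℒ.exists_enum_eq j
  have hb : B.birth t = ℒ.enum r := hj.symm.trans hr.symm
  rw [hb] at hlt ⊢
  cases hd : B.death t with
  | top => exact ⟨_, ℒ.represents_top r⟩
  | coe d =>
    obtain ⟨j', hj'⟩ := B.mem_death t d hd
    obtain ⟨s, hs⟩ := ℒ.exists_enum_eq j'
    have hd' : d = ℒ.enum s := hj'.symm.trans hs.symm
    rw [hd, hd', WithTop.coe_lt_coe] at hlt
    rw [hd']
    exact ⟨_, ℒ.represents_coe hlt⟩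

end FiniteOpenComplex

end ConicComplex
end

/-! ### The bijection between the two barcodes -/

theorem theorem6p4 {k : Type u} [Field k] (ℒ : ConicComplex.FiniteOpenComplex k) (n : ℤ) :
    (∃! B, ConicComplex.IsModuleBarcode (ℒ.restricted.homology n) B) ∧
    (∃! C, ConicComplex.IsSheafBarcode (ℒ.cpx.homology n) C) ∧
    ∀ B C, ConicComplex.IsModuleBarcode (ℒ.restricted.homology n) B →
      ConicComplex.IsSheafBarcode (ℒ.cpx.homology n) C →
      ∃ e : ConicComplex.Bars B ≃ ConicComplex.Bars C,
        ∀ b, (e b).1 = ConicComplex.alphaInv (ℒ.iShriek b.1) := by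
  -- The same family of bars `D` is used below for both abelian categories; this is what matches the
  -- two barcodes.
  obtain ⟨D⟩ := (ℒ.matrixComplex n).nonempty_bars
  choose I hI using fun t => ℒ.exists_represents D t
  let g := fun t => ConicComplex.alphaInv (ℒ.iShriek (I t))
  obtain ⟨e₁⟩ := D.iso _ (ConicComplex.moduleRays k ℒ.i_monotone)
  obtain ⟨e₂⟩ := D.iso _ (ConicComplex.sheafRays k)
  have hB := ConicComplex.isModuleBarcode_multiplicity I _ (fun t => (hI t).module)
    (ℒ.restrictedHomologyIso n ≪≫ e₁)
  have hC := ConicComplex.isSheafBarcode_multiplicity g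
    (fun t => ⟨(hI t).nonempty, (hI t).ordConnected⟩) _ (fun t => (hI t).sheaf)
    (ℒ.cpxHomologyIso n ≪≫ e₂)
  refine ⟨⟨_, hB, fun B h => h.unique hB⟩, ⟨_, hC, fun C h => h.unique hC⟩, ?_⟩
  intro B C hB' hC'
  obtain rfl := hB'.unique hB
  obtain rfl := hC'.unique hC
  -- By uniqueness both barcodes are the multisets of values of families on the index set of `D`,
  -- and the bijection passes through this set. Injectivity of the map on intervals is thus not
  -- needed.
  refine ⟨(ConicComplex.barsMultiplicityEquiv I).trans
    (ConicComplex.barsMultiplicityEquiv g).symm, fun b => ?_⟩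
  rw [← ConicComplex.apply_barsMultiplicityEquiv I b,
    ← ConicComplex.apply_barsMultiplicityEquiv g, Equiv.trans_apply, Equiv.apply_symm_apply]
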